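/- **Setting.** Write $\overline{\mathbb N}=\mathbb N\cup\{\infty\}$. For $k\in\{2,3,\dots,\infty\}^N$ let $\mathbb Z^N_k=\prod_{j}\mathbb Z/k(j)\mathbb Z$ with $\infty\mathbb Z=\{0\}$. A normalized $2$-cocycle of an Abelian group $G$ is a map $\sigma:G\times G\to\mathbb T$ with $\sigma(x,y)\sigma(x+y,z)=\sigma(x,y+z)\sigma(y,z)$, $\sigma(0,x)=\sigma(x,0)=1$ and $\sigma(x,-x)=1$. For such a cocycle of $\mathbb Z^N_k$ let $W^m_{k,\sigma}$ be the unitary of $\ell^2(\mathbb Z^N_k)$ given by $(W^m_{k,\sigma}\xi)(n)=\sigma(m,n-m)\xi(n-m)$, and let $C^*(\mathbb Z^N_k,\sigma)$ be the norm closure of the $*$-algebra generated by these unitaries. Cocycles of $\mathbb Z^N_k$ are regarded as cocycles of $\mathbb Z^N$. Let $2\le d\le d'$. For $n\in\overline{\mathbb N}$ let $(k_n,\sigma_n)$ and $(k'_n,\sigma'_n)$ consist of $k_n\in\{2,3,\dots,\infty\}^d$, $k'_n\in\{2,3,\dots,\infty\}^{d'}$, and normalized $2$-cocycles $\sigma_n$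 of $\mathbb Z^d_{k_n}$ and $\sigma'_n$ of $\mathbb Z^{d'}_{k'_n}$, where all the components of $k_\infty$ and $k'_\infty$ are $\infty$, and, as $n\to\infty$, $k_n\to k_\infty$, $k'_n\to k'_\infty$ componentwise and $\sigma_n\to\sigma_\infty$, $\sigma'_n\to\sigma'_\infty$ pointwise. Let $f$ be a permutation of $\{1,\dots,d'\}$ of order $2$ without fixed points. Put $\mathfrak B_n=C^*(\mathbb Z^{d'}_{k'_n},\sigma'_n)$ and $U_{n,j}=W^{e_j}_{k'_n,\sigma'_n}$, and assume that: 1. $\{d+1,\dots,d'\}\subseteq f(\{1,\dots,d\})$; 2. $k'_n(f(j))=k'_n(j)=k_n(j)$ for all $j\in\{1,\dots,d\}$; 3. the restriction of $\sigma'_n$ to $\mathbb Z^d_{k_n}\times\{0\}$ is cohomologous to $\sigma_n$; 4. for $j\in\{1,\dots,d\}$ and $s\in\{1,\dots,d'\}$, $U_{n,f(j)}U_{n,s}=U_{n,s}U_{n,f(j)}$ unless $s=j$ and $k_n(j)<\infty$, in which case $U_{n,f(j)}U_{n,j}=\exp\left(\pm\frac{2i\pi}{k_n(j)}\right)U_{n,j}U_{n,f(j)}$,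 with the sign $+$ if $j<f(j)$ and $-$ if $j>f(j)$. Let $\mathfrak A_n=C^*(U_{n,1},\dots,U_{n,d})\subseteq\mathfrak B_n$ and $\mathscr H_n=\ell^2(\mathbb Z^{d'}_{k'_n})$. An element of $\mathfrak B_n$ is finitely supported if it is of the form $\sum_m g(m)W^m_{k'_n,\sigma'_n}$ with $g$ finitely supported. Let $\langle m,m\rangle_n=\sum_{j:\,k'_n(j)=\infty}m_j^2$. For $j$ with $k'_n(j)=\infty$ let $(\partial_{n,j}\xi)(m)=i\,m_j\xi(m)$ and $\partial^j_n\left(\sum_m g(m)W^m\right)=\sum_m i\,m_j\,g(m)W^m$. For $a\in\mathfrak B_n$ and $\xi\in\mathscr H_n$ let $[a,\xi]=a\xi-J_na^*J_n\xi$, where $(J_n\xi)(m)=\overline{\xi(-m)}$. For $j\in\{1,\dots,d\}$ let $$X_{n,j}=\tfrac12\left(U_{n,f(j)}+U_{n,f(j)}^*\right),\qquad Y_{n,j}=\tfrac{\varepsilon_j}{2i}\left(U_{n,f(j)}-U_{n,f(j)}^*\right),$$ where $\varepsilon_j=1$ if $f(j)>j$ and $\varepsilon_j=-1$ if $f(j)<j$.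 Define operators $\Gamma_{n,1},\dots,\Gamma_{n,d+d'}$ as follows: - for $j\le d$ and $k_n(j)=\infty$: $\Gamma_{n,j}=X_{n,j}\partial_{n,j}$ and $\Gamma_{n,d+j}=Y_{n,j}\partial_{n,j}$; - for $j\le d$ and $k_n(j)<\infty$: $\Gamma_{n,j}\xi=\frac{-k_n(j)}{2i\pi}[Y_{n,j},\xi]$ and $\Gamma_{n,d+j}\xi=\frac{k_n(j)}{2i\pi}[X_{n,j},\xi]$; - for $d<j\le d'$ and $k'_n(j)=\infty$: $\Gamma_{n,d+j}=\partial_{n,j}$; - for $d<j\le d'$ and $k'_n(j)<\infty$: $\Gamma_{n,d+j}=\frac{k'_n(j)}{2i\pi}\left(1-\frac{v-v^*}{2i}\right)$, where $(v\xi)(m)=\exp\left(\frac{2i\pi m_j}{k'_n(j)}\right)\xi(m)$. Let $\mathrm{Cl}(\mathbb C^{d+d'})$ be the complex Clifford $*$-algebra with generators $\gamma_j=-\gamma_j^*$, $\gamma_j\gamma_s+\gamma_s\gamma_j=-2\delta_{js}$, and let $c$ be a faithful $*$-representation of it on a finite dimensional Hilbert space $\mathscr C$. Let $\mathscr J_n=\mathscr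 H_n\otimes\mathscr C=\ell^2(\mathbb Z^{d'}_{k'_n},\mathscr C)$, $a^\circ=a\otimes1_{\mathscr C}$, and $$D_n=\sum_{j=1}^{d+d'}\Gamma_{n,j}\otimes c(\gamma_j)\quad\text{on}\quad \mathrm{dom}(D_n)=\left\{\xi\in\mathscr J_n:\left(\sqrt{1+\langle m,m\rangle_n}\,\xi(m)\right)_m\in\mathscr J_n\right\}.$$ **Theorem.** For every $n\in\overline{\mathbb N}$: (i) $(\mathfrak A_n,\mathscr J_n,D_n)$, with $\mathfrak A_n$ acting by $a\mapsto a^\circ$, is a spectral triple: $D_n$ is densely defined, self-adjoint on $\mathrm{dom}(D_n)$ and has compact resolvent, and there is a dense $*$-subalgebra of $\mathfrak A_n$ all of whose elements $a$ satisfy $a^\circ\,\mathrm{dom}(D_n)\subseteq\mathrm{dom}(D_n)$ and have $[D_n,a^\circ]$ bounded on $\mathrm{dom}(D_n)$. (ii) If $a\in\mathfrak A_n$ is finitely supported, then $a^\circ\,\mathrm{dom}(D_n)\subseteq\mathrm{dom}(D_n)$ and, on $\mathrm{dom}(D_n)$, $[D_n,a^\circ]=(\mathrm{id}\otimes c)(\mathrm{grad}_n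 a)$, where $\mathrm{grad}_n a\in\mathfrak B_n\otimes\mathrm{Cl}(\mathbb C^{d+d'})$ is $$\mathrm{grad}_n a=\sum_{\substack{1\le j\le d\\k_n(j)=\infty}}\left(X_{n,j}\,\partial^j_n(a)\otimes\gamma_j+Y_{n,j}\,\partial^j_n(a)\otimes\gamma_{d+j}\right)+\sum_{\substack{1\le j\le d\\k_n(j)<\infty}}\frac{k_n(j)}{2i\pi}\left([X_{n,j},a]\otimes\gamma_{d+j}-[Y_{n,j},a]\otimes\gamma_j\right).$$ -/

import Mathlib

open Filter Topology TensorProduct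
open scoped ComplexConjugate

noncomputable section

namespace FuzzyTori

/-! ### Spectral triples -/

/-- `R` is the (everywhere defined, bounded) inverse of `D - z`. -/
def IsResolventAt {H : Type*} [NormedAddCommGroup H] [InnerProductSpace ℂ H]
    (D : H →ₗ.[ℂ] H) (z : ℂ) (R : H →L[ℂ] H) : Prop :=
  (∀ η : H, ∃ h : R η ∈ D.domain, D ⟨R η, h⟩ - z • R η = η) ∧
    ∀ ξ : D.domain, R (D ξ - z • (ξ : H)) = ξ

/-- The resolvent set of `D` is nonempty and every resolvent of `D` is compact. -/
def HasCompactResolvent {H : Type*} [NormedAddCommGroup H] [InnerProductSpace ℂ H]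
    (D : H →ₗ.[ℂ] H) : Prop :=
  (∃ (z : ℂ) (R : H →L[ℂ] H), IsResolventAt D z R) ∧
    ∀ (z : ℂ) (R : H →L[ℂ] H), IsResolventAt D z R → IsCompactOperator R

/-- `(A, H, D)`, with `A` acting on `H` via the *-representation `π`, is a spectral triple. -/
structure IsSpectralTriple {A : Type*} [CStarAlgebra A] {H : Type*} [NormedAddCommGroup H]
    [InnerProductSpace ℂ H] [CompleteSpace H] (π : A →⋆ₐ[ℂ] (H →L[ℂ] H))
    (D : H →ₗ.[ℂ] H) : Prop where
  dense_domain : Dense (D.domain : Set H)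
  selfAdjoint : IsSelfAdjoint D
  compact_resolvent : HasCompactResolvent D
  exists_smooth_subalgebra : ∃ S : StarSubalgebra ℂ A, Dense (S : Set A) ∧
    ∀ a ∈ S, (∀ ξ ∈ D.domain, π a ξ ∈ D.domain) ∧
      ∃ C : ℝ, ∀ ξ η : D.domain, (η : H) = π a ξ → ‖D η - π a (D ξ)‖ ≤ C * ‖(ξ : H)‖

/-! ### Square-summable families -/

/-- The Hilbert space `ℓ²(ι, E)`. -/
abbrev L2 (ι E : Type*) [NormedAddCommGroup E] : Type _ := lp (fun _ : ι => E) 2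

section Pointwise

variable {ι E F : Type*} [NormedAddCommGroup E]

theorem memℓp_two_iff {f : ι → E} :
    Memℓp (E := fun _ : ι => E) f 2 ↔ Summable fun i => ‖f i‖ ^ 2 := by
  rw [memℓp_gen_iff (by simp)]
  simp

theorem norm_sq_eq (f : L2 ι E) : ‖f‖ ^ 2 = ∑' i, ‖f i‖ ^ 2 := by
  have := lp.norm_rpow_eq_tsum (p := 2) (by simp) f
  simpa using this

theorem summable_norm_sq (f : L2 ι E) : Summable fun i => ‖f i‖ ^ 2 :=
  memℓp_two_iff.1 (lp.memℓp f)

variable [NormedSpace ℂ E] [NormedAddCommGroup F] [NormedSpace ℂ F] {s : ℂ →+* ℂ}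

theorem memℓp_pointwise (e : ι ≃ ι) (T : ι → E →ₛₗ[s] F) (M : ℝ)
    (hT : ∀ i x, ‖T i x‖ ≤ M * ‖x‖) (ξ : L2 ι E) :
    Memℓp (E := fun _ : ι => F) (fun i => T i (ξ (e i))) 2 := by
  rw [memℓp_two_iff]
  refine Summable.of_nonneg_of_le (fun _ => by positivity)
    (fun i => ?_) (((e.summable_iff (f := fun i => ‖ξ i‖ ^ 2)).2 (summable_norm_sq ξ)).mul_left (M ^ 2))
  have := hT i (ξ (e i))
  calc ‖T i (ξ (e i))‖ ^ 2 ≤ (M * ‖ξ (e i)‖) ^ 2 := by gcongr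
    _ = M ^ 2 * ‖ξ (e i)‖ ^ 2 := by ring

/-- The bounded operator `ξ ↦ (i ↦ T i (ξ (e i)))` on square-summable families, for a uniformly
bounded family `T` of (semi)linear maps and a permutation `e` of the index set. -/
def pointwise (e : ι ≃ ι) (T : ι → E →ₛₗ[s] F) (M : ℝ) (hM : 0 ≤ M)
    (hT : ∀ i x, ‖T i x‖ ≤ M * ‖x‖) : L2 ι E →SL[s] L2 ι F :=
  LinearMap.mkContinuous
    { toFun := fun ξ => ⟨fun i => T i (ξ (e i)), memℓp_pointwise e T M hT ξ⟩
      map_add' := fun ξ η => by ext i; exact map_add (T i) _ _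
      map_smul' := fun c ξ => by ext i; exact (T i).map_smulₛₗ c _ }
    M (fun ξ => by
      refine le_of_sq_le_sq ?_ (by positivity)
      rw [norm_sq_eq, mul_pow, norm_sq_eq, ← tsum_mul_left, ← e.tsum_eq (fun i => M ^ 2 * ‖ξ i‖ ^ 2)]
      refine Summable.tsum_le_tsum (fun i => ?_)
        (memℓp_two_iff.1 (memℓp_pointwise e T M hT ξ))
        ((e.summable_iff (f := fun i => M ^ 2 * ‖ξ i‖ ^ 2)).2 ((summable_norm_sq ξ).mul_left (M ^ 2)))
      calc ‖T i (ξ (e i))‖ ^ 2 ≤ (M * ‖ξ (e i)‖) ^ 2 := by gcongr; exact hT i _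
        _ = M ^ 2 * ‖ξ (e i)‖ ^ 2 := by ring)

@[simp]
theorem pointwise_apply (e : ι ≃ ι) (T : ι → E →ₛₗ[s] F) (M : ℝ) (hM : 0 ≤ M)
    (hT : ∀ i x, ‖T i x‖ ≤ M * ‖x‖) (ξ : L2 ι E) (i : ι) :
    pointwise e T M hM hT ξ i = T i (ξ (e i)) := rfl

/-- The unitary `ξ ↦ (i ↦ u i * ξ (e i))` of `ℓ²(ι)`. -/
def weightedShift (e : ι ≃ ι) (u : ι → Circle) : L2 ι ℂ →L[ℂ] L2 ι ℂ :=
  pointwise e (fun i => LinearMap.mulLeft ℂ (u i : ℂ)) 1 zero_le_one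
    (fun i x => by simp [Circle.norm_coe])

/-- Pointwise application of a bounded linear map. -/
def pointwiseMap (ι : Type*) (T : E →L[ℂ] F) : L2 ι E →L[ℂ] L2 ι F :=
  pointwise (Equiv.refl ι) (fun _ => (T : E →ₗ[ℂ] F)) ‖T‖ (norm_nonneg T) (fun _ x => T.le_opNorm x)

@[simp]
theorem pointwiseMap_apply (T : E →L[ℂ] F) (ξ : L2 ι E) (i : ι) :
    pointwiseMap ι T ξ i = T (ξ i) := rfl

end Pointwise

/-! ### The identification of `ℓ²(ι) ⊗ 𝒞` with `ℓ²(ι, 𝒞)` -/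

section Tensor

variable (ι : Type*) {C : Type*} [NormedAddCommGroup C] [InnerProductSpace ℂ C]

/-- `ξ ↦ ξ ⊗ v`. -/
def tmulRight (v : C) : L2 ι ℂ →L[ℂ] L2 ι C :=
  pointwiseMap ι (ContinuousLinearMap.toSpanSingleton ℂ v)

/-- `ξ ↦ (i ↦ ⟪v, ξ i⟫)`. -/
def slice (v : C) : L2 ι C →L[ℂ] L2 ι ℂ := pointwiseMap ι (innerSL ℂ v)

variable {ι}

@[simp]
theorem tmulRight_apply (v : C) (ξ : L2 ι ℂ) (i : ι) : tmulRight ι v ξ i = ξ i • v := rfl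

@[simp]
theorem slice_apply (v : C) (ξ : L2 ι C) (i : ι) : slice ι v ξ i = inner ℂ v (ξ i) := rfl

theorem tmulRight_sum_smul {κ : Type*} (S : Finset κ) (c : κ → ℂ) (v : κ → C) (ξ : L2 ι ℂ) :
    tmulRight ι (∑ i ∈ S, c i • v i) ξ = ∑ i ∈ S, c i • tmulRight ι (v i) ξ := by
  ext m
  rw [lp.coeFn_sum, Finset.sum_apply]
  simp only [tmulRight_apply, Finset.smul_sum, lp.coeFn_smul, Pi.smul_apply]
  exact Finset.sum_congr rfl fun i _ => smul_comm _ _ _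

theorem tmulRight_add (v w : C) : tmulRight ι (v + w) = tmulRight ι v + tmulRight ι w := by
  ext ξ m
  simp

theorem tmulRight_smul (c : ℂ) (v : C) : tmulRight ι (c • v) = c • tmulRight ι v := by
  ext ξ m
  simp [smul_comm c]

theorem inner_tmulRight_left (v : C) (ξ : L2 ι ℂ) (η : L2 ι C) :
    inner ℂ (tmulRight ι v ξ) η = inner ℂ ξ (slice ι v η) := by
  rw [lp.inner_eq_tsum, lp.inner_eq_tsum]
  refine tsum_congr fun i => ?_
  simp [inner_smul_left, mul_comm]

theorem slice_tmulRight (v w : C) (ξ : L2 ι ℂ) :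
    slice ι v (tmulRight ι w ξ) = inner ℂ v w • ξ := by
  ext m
  simp [mul_comm]

variable [FiniteDimensional ℂ C]

/-- The operator `a ⊗ t` on `ℓ²(ι) ⊗ 𝒞 = ℓ²(ι, 𝒞)`, written with an orthonormal basis of `𝒞`. -/
def tensorOp (a : L2 ι ℂ →L[ℂ] L2 ι ℂ) (t : C →L[ℂ] C) : L2 ι C →L[ℂ] L2 ι C :=
  ∑ i, tmulRight ι (t (stdOrthonormalBasis ℂ C i)) ∘L a ∘L slice ι (stdOrthonormalBasis ℂ C i)

theorem sum_tmulRight_slice (ξ : L2 ι C) :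
    ∑ i, tmulRight ι (stdOrthonormalBasis ℂ C i) (slice ι (stdOrthonormalBasis ℂ C i) ξ) = ξ := by
  ext m
  rw [lp.coeFn_sum, Finset.sum_apply]
  simp only [tmulRight_apply, slice_apply]
  exact (stdOrthonormalBasis ℂ C).sum_repr' (ξ m)

/-- `(a ⊗ t)(ξ ⊗ v) = a ξ ⊗ t v`. -/
theorem tensorOp_tmulRight (a : L2 ι ℂ →L[ℂ] L2 ι ℂ) (t : C →L[ℂ] C) (v : C) (ξ : L2 ι ℂ) :
    tensorOp a t (tmulRight ι v ξ) = tmulRight ι (t v) (a ξ) := by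
  have h : ∀ i, slice ι (stdOrthonormalBasis ℂ C i) (tmulRight ι v ξ)
      = inner ℂ (stdOrthonormalBasis ℂ C i) v • ξ := fun i => by
    ext m
    simp [mul_comm]
  conv_rhs => rw [← (stdOrthonormalBasis ℂ C).sum_repr' v, map_sum]
  simp only [map_smul, tmulRight_sum_smul]
  simp [tensorOp, h]

theorem ext_tmulRight {S T : L2 ι C →L[ℂ] L2 ι C}
    (h : ∀ v ξ, S (tmulRight ι v ξ) = T (tmulRight ι v ξ)) : S = T := by
  ext1 ξ
  rw [← sum_tmulRight_slice ξ, map_sum, map_sum]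
  exact Finset.sum_congr rfl fun i _ => h _ _

/-- The *-representation `a ↦ a° = a ⊗ 1`. -/
def ampliation (ι C : Type*) [NormedAddCommGroup C] [InnerProductSpace ℂ C]
    [FiniteDimensional ℂ C] : (L2 ι ℂ →L[ℂ] L2 ι ℂ) →⋆ₐ[ℂ] (L2 ι C →L[ℂ] L2 ι C) where
  toFun a := tensorOp a 1
  map_one' := ext_tmulRight fun v ξ => by simp [tensorOp_tmulRight]
  map_mul' a b := ext_tmulRight fun v ξ => by simp [tensorOp_tmulRight]
  map_zero' := ext_tmulRight fun v ξ => by simp [tensorOp_tmulRight]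
  map_add' a b := ext_tmulRight fun v ξ => by simp [tensorOp_tmulRight]
  commutes' c := ext_tmulRight fun v ξ => by
    simp [tensorOp_tmulRight, Algebra.algebraMap_eq_smul_one]
  map_star' a := by
    rw [ContinuousLinearMap.star_eq_adjoint, ContinuousLinearMap.star_eq_adjoint,
      ContinuousLinearMap.eq_adjoint_iff]
    intro x y
    rw [← sum_tmulRight_slice x, ← sum_tmulRight_slice y]
    simp only [map_sum, sum_inner, inner_sum, tensorOp_tmulRight]
    refine Finset.sum_congr rfl fun i _ => Finset.sum_congr rfl fun j _ => ?_
    simp [inner_tmulRight_left, slice_tmulRight, ContinuousLinearMap.adjoint_inner_left]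

@[simp]
theorem ampliation_apply (a : L2 ι ℂ →L[ℂ] L2 ι ℂ) : ampliation ι C a = tensorOp a 1 := rfl

/-- `a ⊗ t` depends bilinearly on `a` and `t`. -/
def tensorOpBilin (ι C : Type*) [NormedAddCommGroup C] [InnerProductSpace ℂ C]
    [FiniteDimensional ℂ C] :
    (L2 ι ℂ →L[ℂ] L2 ι ℂ) →ₗ[ℂ] (C →L[ℂ] C) →ₗ[ℂ] (L2 ι C →L[ℂ] L2 ι C) :=
  LinearMap.mk₂ ℂ tensorOp
    (fun a b t => ext_tmulRight fun v ξ => by simp [tensorOp_tmulRight])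
    (fun c a t => ext_tmulRight fun v ξ => by simp [tensorOp_tmulRight])
    (fun a t u => ext_tmulRight fun v ξ => by simp [tensorOp_tmulRight, tmulRight_add])
    (fun c a t => ext_tmulRight fun v ξ => by simp [tensorOp_tmulRight, tmulRight_smul])

end Tensor

/-! ### Cocycles -/

/-- The group `ℤ^N_k = ∏ j, ℤ / k(j) ℤ`, where `∞ ℤ = {0}` (`ZMod 0 = ℤ` and `(⊤ : ℕ∞).toNat = 0`). -/
abbrev Zk {N : ℕ} (k : Fin N → ℕ∞) : Type := ∀ j, ZMod (k j).toNat

/-- The canonical surjection `ℤ^N → ℤ^N_k`. -/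
def quot {N : ℕ} (k : Fin N → ℕ∞) (m : Fin N → ℤ) : Zk k := fun j => (m j : ZMod (k j).toNat)

/-- The integer representative of the `j`-th coordinate: the coordinate itself if `k j = ∞`, and
the representative in `{0, …, k j - 1}` if `k j` is finite and positive. -/
def intCoord {N : ℕ} {k : Fin N → ℕ∞} (m : Zk k) (j : Fin N) : ℤ := (m j).cast

/-- `⟨e_j, m⟩_k`: the coordinate `m j` if `k j = ∞`, and `0` otherwise. -/
def infCoord {N : ℕ} {k : Fin N → ℕ∞} (m : Zk k) (j : Fin N) : ℤ :=
  if k j = ⊤ then intCoord m j else 0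

/-- `⟨m, m'⟩_k`, the sum of `m j * m' j` over the `j` with `k j = ∞`. -/
def pairing {N : ℕ} {k : Fin N → ℕ∞} (m m' : Zk k) : ℝ :=
  ∑ j with k j = ⊤, (intCoord m j : ℝ) * intCoord m' j

/-- Normalized `2`-cocycles of an Abelian group, with values in the circle group. -/
structure NormalizedCocycle (G : Type*) [AddCommGroup G] where
  toFun : G → G → Circle
  cocycle : ∀ x y z, toFun x y * toFun (x + y) z = toFun x (y + z) * toFun y z
  zero_left : ∀ x, toFun 0 x = 1
  zero_right : ∀ x, toFun x 0 = 1
  normalized : ∀ x, toFun x (-x) = 1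

instance (G : Type*) [AddCommGroup G] :
    CoeFun (NormalizedCocycle G) (fun _ => G → G → Circle) := ⟨NormalizedCocycle.toFun⟩

/-! ### Quantum and fuzzy tori -/

section Torus

variable {N : ℕ} {k : Fin N → ℕ∞}

/-- The unitary `W^m ξ : n ↦ σ(m, n - m) ξ(n - m)`. -/
def W (σ : NormalizedCocycle (Zk k)) (m : Zk k) : L2 (Zk k) ℂ →L[ℂ] L2 (Zk k) ℂ :=
  weightedShift (Equiv.subRight m) (fun n => σ m (n - m))

/-- The C*-algebra `C*(ℤ^N_k, σ)`. -/
def torus (σ : NormalizedCocycle (Zk k)) : StarSubalgebra ℂ (L2 (Zk k) ℂ →L[ℂ] L2 (Zk k) ℂ) :=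
  (StarAlgebra.adjoin ℂ (Set.range (W σ))).topologicalClosure

/-- `W^m` as an element of the torus. -/
def Wt (σ : NormalizedCocycle (Zk k)) (m : Zk k) : torus σ :=
  ⟨W σ m, StarSubalgebra.le_topologicalClosure _ (StarAlgebra.subset_adjoin _ _ ⟨m, rfl⟩)⟩

/-- The canonical unitaries `U_j = W^{e_j}`. -/
def U (σ : NormalizedCocycle (Zk k)) (j : Fin N) : torus σ := Wt σ (Pi.single j 1)

/-- `π(f) = ∑ m, f(m) W^m` for finitely supported `f`. -/
def rep (σ : NormalizedCocycle (Zk k)) (f : Zk k →₀ ℂ) : torus σ := f.sum fun m c => c • Wt σ m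

/-- The C*-subalgebra `C*(U_1, …, U_d)` generated by the first `d` canonical unitaries. -/
def subtorus (d : ℕ) (σ : NormalizedCocycle (Zk k)) :
    StarSubalgebra ℂ (L2 (Zk k) ℂ →L[ℂ] L2 (Zk k) ℂ) :=
  (StarAlgebra.adjoin ℂ {T | ∃ j : Fin N, (j : ℕ) < d ∧ T = (U σ j).1}).topologicalClosure

instance (d : ℕ) (σ : NormalizedCocycle (Zk k)) : CStarAlgebra (subtorus d σ) :=
  StarSubalgebra.cstarAlgebra _ (h_closed := StarSubalgebra.isClosed_topologicalClosure _)

/-- The conjugate linear isometric involution `J ξ : m ↦ conj (ξ (-m))`. -/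
def J (k : Fin N → ℕ∞) : L2 (Zk k) ℂ →L⋆[ℂ] L2 (Zk k) ℂ :=
  pointwise (Equiv.neg (Zk k)) (fun _ => (starLinearEquiv ℂ (A := ℂ) : ℂ →ₗ⋆[ℂ] ℂ)) 1
    zero_le_one (fun _ x => by simp)

/-- The right action `ξ ↦ ξ · a = J a* J ξ`. -/
def rightAct (a : L2 (Zk k) ℂ →L[ℂ] L2 (Zk k) ℂ) : L2 (Zk k) ℂ →L[ℂ] L2 (Zk k) ℂ :=
  ((J k).comp (ContinuousLinearMap.adjoint a)).comp (J k)

/-- The operator `ξ ↦ [a, ξ] = a ξ - ξ · a`. -/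
def adOp (a : L2 (Zk k) ℂ →L[ℂ] L2 (Zk k) ℂ) : L2 (Zk k) ℂ →L[ℂ] L2 (Zk k) ℂ :=
  a - rightAct a

/-- The unitary `v^z ξ : m ↦ z^m ξ(m)`, where `z^m = ∏ j, z_j ^ {m_j}`; it is only meant for `z` in
the dual group of `ℤ^N_k`, for which `z^m` does not depend on the representatives of the `m_j`. -/
def dualUnitary (k : Fin N → ℕ∞) (z : Fin N → Circle) : L2 (Zk k) ℂ →L[ℂ] L2 (Zk k) ℂ :=
  weightedShift (Equiv.refl (Zk k)) (fun m => ∏ j, z j ^ intCoord m j)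

/-- The element `z_j` of the dual group: `exp(2 i π / k(j))` at the index `j` and `1` elsewhere if
`k(j)` is finite, and `1` if `k(j) = ∞`. -/
def zElt (k : Fin N → ℕ∞) (j : Fin N) : Fin N → Circle :=
  if k j = ⊤ then 1 else Pi.mulSingle j (Circle.exp (2 * Real.pi / (k j).toNat))

end Torus

/-- Real part `(a + a*) / 2`. -/
def rePart {A : Type*} [Ring A] [StarRing A] [Algebra ℂ A] (a : A) : A :=
  (1 / 2 : ℂ) • (a + star a)

/-- Imaginary part `(a - a*) / (2 i)`. -/
def imPart {A : Type*} [Ring A] [StarRing A] [Algebra ℂ A] (a : A) : A :=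
  (1 / (2 * Complex.I) : ℂ) • (a - star a)

/-! ### Clifford algebras -/

/-- The form `v ↦ -∑ j, v_j ^ 2` on `ℂ^N`. -/
abbrev negForm (N : ℕ) : QuadraticForm ℂ (Fin N → ℂ) :=
  QuadraticMap.weightedSumSquares ℂ (fun _ : Fin N => (-1 : ℂ))

/-- The Clifford algebra of `ℂ^N`, with the sign convention `γ_j ^ 2 = -1`. -/
abbrev Cl (N : ℕ) : Type := CliffordAlgebra (negForm N)

/-- The canonical generators of the Clifford algebra. -/
def gam {N : ℕ} (j : Fin N) : Cl N := CliffordAlgebra.ι (negForm N) (Pi.single j 1)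

theorem gam_mul_gam_add {N : ℕ} (i j : Fin N) :
    (gam i * gam j + gam j * gam i : Cl N) = if i = j then -2 else 0 := by
  rw [gam, gam, CliffordAlgebra.ι_mul_ι_add_swap, QuadraticMap.polar]
  simp only [QuadraticMap.weightedSumSquares_apply, ← Finset.sum_sub_distrib]
  split_ifs with h
  · subst h
    rw [Finset.sum_eq_single i]
    · norm_num
      exact map_ofNat (algebraMap ℂ (Cl N)) 2
    · intro b _ hb
      simp [hb]
    · simp
  · rw [Finset.sum_eq_zero, map_zero]
    intro b _
    by_cases hi : b = i
    · subst hi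
      simp [h]
    · by_cases hj : b = j
      · subst hj
        simp [hi]
      · simp [hi, hj]

/-- A faithful *-representation of the Clifford algebra of `ℂ^N` on a Hilbert space. The involution
of the Clifford algebra is the conjugate linear antiautomorphism determined by `γ_j* = -γ_j`, so
that an algebra morphism preserves it if and only if it does so on the generators. -/
structure CliffordRep (N : ℕ) (C : Type*) [NormedAddCommGroup C] [InnerProductSpace ℂ C]
    [CompleteSpace C] where
  toAlgHom : Cl N →ₐ[ℂ] (C →L[ℂ] C)
  injective : Function.Injective toAlgHom
  star_gam : ∀ j, star (toAlgHom (gam j)) = -toAlgHom (gam j)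

/-! ### The Dirac operators -/

section Dirac

variable {N : ℕ} (k : Fin N → ℕ∞)

/-- The `ξ` in `ℓ²(ℤ^N_k, E)` such that `m ↦ √(1 + ⟨m, m⟩) ξ(m)` is square-summable. -/
def sobolev (E : Type*) [NormedAddCommGroup E] [NormedSpace ℂ E] :
    Submodule ℂ (L2 (Zk k) E) where
  carrier := {ξ | Memℓp (E := fun _ : Zk k => E)
    (fun m => ((√(1 + pairing m m) : ℝ) : ℂ) • ξ m) 2}
  add_mem' {ξ η} hξ hη := by
    have := hξ.add hη
    simpa [Pi.add_def, smul_add] using this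
  zero_mem' := by
    change Memℓp (E := fun _ : Zk k => E) (fun m => _ • (0 : E)) 2
    simp only [smul_zero]
    exact zero_memℓp
  smul_mem' c ξ hξ := by
    have := hξ.const_smul c
    simpa [Pi.smul_def, smul_comm c] using this

variable {k}

theorem memℓp_infCoord (j : Fin N) (ξ : sobolev k ℂ) :
    Memℓp (E := fun _ : Zk k => ℂ) (fun m => Complex.I * infCoord m j * ξ.1 m) 2 := by
  have h : Memℓp (E := fun _ : Zk k => ℂ)
    (fun m => ((√(1 + pairing m m) : ℝ) : ℂ) • ξ.1 m) 2 := ξ.2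
  refine h.mono' fun m => ?_
  simp only [norm_mul, smul_eq_mul, Complex.norm_I, one_mul, Complex.norm_real, Real.norm_eq_abs,
    abs_of_nonneg (Real.sqrt_nonneg _), Complex.norm_intCast]
  refine mul_le_mul_of_nonneg_right (Real.abs_le_sqrt ?_) (norm_nonneg _)
  rw [infCoord]
  have hs : ∀ i : Fin N, 0 ≤ (intCoord m i : ℝ) * intCoord m i := fun i => mul_self_nonneg _
  split_ifs with hj
  · have := Finset.single_le_sum (s := Finset.univ.filter fun i => k i = ⊤) (fun i _ => hs i)
      (Finset.mem_filter.2 ⟨Finset.mem_univ j, hj⟩)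
    rw [pairing]
    nlinarith
  · have : 0 ≤ pairing m m := Finset.sum_nonneg fun i _ => hs i
    simp only [Int.cast_zero]
    linarith

/-- The derivation `∂_j ξ : m ↦ i ⟨e_j, m⟩ ξ(m)`. -/
def partialOp (j : Fin N) : sobolev k ℂ →ₗ[ℂ] L2 (Zk k) ℂ where
  toFun ξ := ⟨fun m => Complex.I * infCoord m j * ξ.1 m, memℓp_infCoord j ξ⟩
  map_add' ξ η := by ext m; exact mul_add _ _ _
  map_smul' c ξ := by ext m; exact mul_left_comm _ _ _

/-- The derivation `∂^j` on finitely supported functions: `(∂^j f)(m) = i ⟨e_j, m⟩ f(m)`. -/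
def partialFin (j : Fin N) (f : Zk k →₀ ℂ) : Zk k →₀ ℂ :=
  Finsupp.onFinset f.support (fun m => Complex.I * infCoord m j * f m) (by
    intro m hm
    rw [Finsupp.mem_support_iff]
    exact fun h => hm (by simp [h]))

variable (σ : NormalizedCocycle (Zk k)) (f : Equiv.Perm (Fin N))

/-- The sign of `f(j) - j`. -/
def fsgn (j : Fin N) : ℂ := if j < f j then 1 else -1

/-- `X_j = Re U_{f(j)}`. -/
def X (j : Fin N) : torus σ := rePart (U σ (f j))

/-- `Y_j = fsgn(j) Im U_{f(j)}`. -/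
def Y (j : Fin N) : torus σ := fsgn f j • imPart (U σ (f j))

/-- The operator `Γ_j`, for `1 ≤ j ≤ d`. -/
def Gamma₁ (j : Fin N) : sobolev k ℂ →ₗ[ℂ] L2 (Zk k) ℂ :=
  if k j = ⊤ then ((X σ f j).1 : L2 (Zk k) ℂ →ₗ[ℂ] L2 (Zk k) ℂ) ∘ₗ partialOp j
  else (-((k j).toNat : ℂ) / (2 * Complex.I * Real.pi)) •
    ((adOp (Y σ f j).1 : L2 (Zk k) ℂ →ₗ[ℂ] L2 (Zk k) ℂ) ∘ₗ (sobolev k ℂ).subtype)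

/-- The operator `Γ_{d+j}`, for `1 ≤ j ≤ d` and for `d < j ≤ N`. -/
def Gamma₂ (d : ℕ) (j : Fin N) : sobolev k ℂ →ₗ[ℂ] L2 (Zk k) ℂ :=
  if (j : ℕ) < d then
    if k j = ⊤ then ((Y σ f j).1 : L2 (Zk k) ℂ →ₗ[ℂ] L2 (Zk k) ℂ) ∘ₗ partialOp j
    else (((k j).toNat : ℂ) / (2 * Complex.I * Real.pi)) •
      ((adOp (X σ f j).1 : L2 (Zk k) ℂ →ₗ[ℂ] L2 (Zk k) ℂ) ∘ₗ (sobolev k ℂ).subtype)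
  else
    if k j = ⊤ then partialOp j
    else (((k j).toNat : ℂ) / (2 * Complex.I * Real.pi)) •
      (((1 - imPart (dualUnitary k (zElt k j)) : L2 (Zk k) ℂ →L[ℂ] L2 (Zk k) ℂ) :
        L2 (Zk k) ℂ →ₗ[ℂ] L2 (Zk k) ℂ) ∘ₗ (sobolev k ℂ).subtype)

/-- The operator `Γ_j`, for `1 ≤ j ≤ d + N`; here `Fin.castAdd N j` is the index `j` and
`Fin.natAdd d j` is the index `d + j`. -/
def Gamma {d : ℕ} (hd : d ≤ N) : Fin (d + N) → (sobolev k ℂ →ₗ[ℂ] L2 (Zk k) ℂ) :=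
  Fin.addCases (fun j => Gamma₁ σ f (Fin.castLE hd j)) (fun j => Gamma₂ σ f d j)

variable {C : Type*} [NormedAddCommGroup C] [InnerProductSpace ℂ C]

theorem slice_mem_sobolev (v : C) (ξ : sobolev k C) : slice (Zk k) v ξ.1 ∈ sobolev k ℂ := by
  have h : Memℓp (E := fun _ : Zk k => C)
    (fun m => ((√(1 + pairing m m) : ℝ) : ℂ) • ξ.1 m) 2 := ξ.2
  exact (lp.memℓp (pointwiseMap (Zk k) (innerSL ℂ v) ⟨_, h⟩)).mono' fun m =>
    (congrArg norm (inner_smul_right (𝕜 := ℂ) v (ξ.1 m) _).symm).le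

/-- `ξ ↦ (m ↦ ⟪v, ξ m⟫)` as a map between Sobolev spaces. -/
def sobolevSlice (v : C) : sobolev k C →ₗ[ℂ] sobolev k ℂ :=
  ((slice (Zk k) v : L2 (Zk k) C →ₗ[ℂ] L2 (Zk k) ℂ) ∘ₗ (sobolev k C).subtype).codRestrict
    (sobolev k ℂ) (slice_mem_sobolev v)

variable [FiniteDimensional ℂ C]

/-- The operator `Γ ⊗ t` on `sobolev k C`, for an operator `Γ` defined on `sobolev k ℂ`. -/
def tensorUnbounded (Γ : sobolev k ℂ →ₗ[ℂ] L2 (Zk k) ℂ) (t : C →L[ℂ] C) :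
    sobolev k C →ₗ[ℂ] L2 (Zk k) C :=
  ∑ i, (tmulRight (Zk k) (t (stdOrthonormalBasis ℂ C i)) : L2 (Zk k) ℂ →ₗ[ℂ] L2 (Zk k) C) ∘ₗ
    Γ ∘ₗ sobolevSlice (stdOrthonormalBasis ℂ C i)

/-- The Dirac operator `∑ j, Γ_j ⊗ c(γ_j)`, for `1 ≤ j ≤ d + N`. -/
def dirac {d : ℕ} (hd : d ≤ N) [CompleteSpace C] (c : CliffordRep (d + N) C) :
    L2 (Zk k) C →ₗ.[ℂ] L2 (Zk k) C where
  domain := sobolev k C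
  toFun := ∑ j, tensorUnbounded (Gamma σ f hd j) (c.toAlgHom (gam j))

/-- The gradient of `π(g)`, for `g` finitely supported, as an element of `𝔅 ⊗ Cl(ℂ^{d+N})`. -/
def grad {d : ℕ} (hd : d ≤ N) (g : Zk k →₀ ℂ) : torus σ ⊗[ℂ] Cl (d + N) :=
  (∑ j : Fin d with k (Fin.castLE hd j) = ⊤,
      ((X σ f (Fin.castLE hd j) * rep σ (partialFin (Fin.castLE hd j) g)) ⊗ₜ[ℂ]
          gam (Fin.castAdd N j) +
        (Y σ f (Fin.castLE hd j) * rep σ (partialFin (Fin.castLE hd j) g)) ⊗ₜ[ℂ]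
          gam (Fin.natAdd d (Fin.castLE hd j)))) +
  ∑ j : Fin d with k (Fin.castLE hd j) ≠ ⊤,
      (((k (Fin.castLE hd j)).toNat : ℂ) / (2 * Complex.I * Real.pi)) •
        (⁅X σ f (Fin.castLE hd j), rep σ g⁆ ⊗ₜ[ℂ] gam (Fin.natAdd d (Fin.castLE hd j)) -
          ⁅Y σ f (Fin.castLE hd j), rep σ g⁆ ⊗ₜ[ℂ] gam (Fin.castAdd N j))

/-- The map `id ⊗ c` from `𝔅 ⊗ Cl(ℂ^M)` to the operators on `ℓ²(ℤ^N_k, 𝒞)`. -/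
def idTensor {M : ℕ} [CompleteSpace C] (c : CliffordRep M C) :
    torus σ ⊗[ℂ] Cl M →ₗ[ℂ] (L2 (Zk k) C →L[ℂ] L2 (Zk k) C) :=
  TensorProduct.lift
    ((tensorOpBilin (Zk k) C).compl₁₂ (torus σ).subtype.toAlgHom.toLinearMap
      c.toAlgHom.toLinearMap)

end Dirac

/-! ### The standing assumptions -/

/-- Pairs `(k_n, σ_n)`, for `n ∈ ℕ ∪ {∞}`, with `k_n(j) ∈ {2, 3, …, ∞}`, such that `(k_n, σ_n)`
converges to `(k_∞, σ_∞)` as `n → ∞` and `k_∞ = (∞, …, ∞)`; cocycles of `ℤ^d_{k_n}` are regarded as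
cocycles of `ℤ^d` and converge pointwise. -/
structure IsApproximation {d : ℕ} (k : ℕ∞ → Fin d → ℕ∞)
    (σ : ∀ n, NormalizedCocycle (Zk (k n))) : Prop where
  two_le : ∀ n j, 2 ≤ k n j
  top : ∀ j, k ⊤ j = ⊤
  tendsto_k : ∀ j, Tendsto (fun n : ℕ => k n j) atTop (𝓝 (k ⊤ j))
  tendsto_σ : ∀ x y : Fin d → ℤ, Tendsto (fun n : ℕ => σ n (quot (k n) x) (quot (k n) y)) atTop
    (𝓝 (σ ⊤ (quot (k ⊤) x) (quot (k ⊤) y)))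

/-- The inclusion `x ↦ (x, 0)` of `ℤ^d` in `ℤ^{d'}`. -/
def extendZero (d d' : ℕ) (x : Fin d → ℤ) (j : Fin d') : ℤ :=
  if h : (j : ℕ) < d then x ⟨j, h⟩ else 0

/-- The commutation relations, and the compatibility conditions, between the `d`-tori given by
`(k_n, σ_n)` and the `d'`-tori given by `(k'_n, σ'_n)`. -/
structure IsInnerification {d d' : ℕ} (hd : d ≤ d') (k : ℕ∞ → Fin d → ℕ∞)
    (σ : ∀ n, NormalizedCocycle (Zk (k n))) (k' : ℕ∞ → Fin d' → ℕ∞)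
    (σ' : ∀ n, NormalizedCocycle (Zk (k' n))) (f : Equiv.Perm (Fin d')) : Prop where
  involutive : ∀ j, f (f j) = j
  no_fixed_point : ∀ j, f j ≠ j
  approximation : IsApproximation k' σ'
  covers : ∀ j : Fin d', d ≤ (j : ℕ) → ∃ i : Fin d, f (Fin.castLE hd i) = j
  k'_f : ∀ n (j : Fin d), k' n (f (Fin.castLE hd j)) = k' n (Fin.castLE hd j)
  k'_eq : ∀ n (j : Fin d), k' n (Fin.castLE hd j) = k n j
  cohomologous : ∀ n, ∃ g : Zk (k n) → Circle, ∀ x y : Fin d → ℤ,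
    σ' n (quot (k' n) (extendZero d d' x)) (quot (k' n) (extendZero d d' y)) =
      g (quot (k n) x) * g (quot (k n) y) * (g (quot (k n) (x + y)))⁻¹ *
        σ n (quot (k n) x) (quot (k n) y)
  commutation : ∀ n (j : Fin d) (s : Fin d'),
    U (σ' n) (f (Fin.castLE hd j)) * U (σ' n) s =
      if k n j ≠ ⊤ ∧ Fin.castLE hd j < f (Fin.castLE hd j) ∧ s = Fin.castLE hd j then
        Complex.exp (2 * Complex.I * Real.pi / (k n j).toNat) •
          (U (σ' n) (Fin.castLE hd j) * U (σ' n) (f (Fin.castLE hd j)))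
      else if k n j ≠ ⊤ ∧ f (Fin.castLE hd j) < Fin.castLE hd j ∧ s = Fin.castLE hd j then
        Complex.exp (-2 * Complex.I * Real.pi / (k n j).toNat) •
          (U (σ' n) (Fin.castLE hd j) * U (σ' n) (f (Fin.castLE hd j)))
      else U (σ' n) s * U (σ' n) (f (Fin.castLE hd j))

end FuzzyTori

end

noncomputable section

namespace FuzzyTori

/-! ### Unbounded self-adjoint operators -/

section Unbounded

variable {H : Type*} [NormedAddCommGroup H] [InnerProductSpace ℂ H] {D : H →ₗ.[ℂ] H}

/-! Each `n` is treated separately, and the Dirac operator is handled as a first order elliptic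
operator. By `dirac_apply` it equals `B + ∑ i, T i ∂_{s i}` on the Sobolev domain, where `B` is
bounded and self-adjoint. Directions with `k j` finite contribute only to `B`. A direction with `k j
= ∞` contributes the coefficients `X_j ⊗ γ_j` and `Y_j ⊗ γ_{d+j}` if `j ≤ d`, and `1 ⊗ γ_{d+j}`
otherwise.

The coefficients satisfy `IsDiracSymbol` for three reasons. As `f j ≠ j`, the operators `X_j` and
`Y_j` do not move the `j`-th coordinate, so they commute with `∂_j`; skewness of `T i` and of the
derivative then makes the operator symmetric. In infinite directions `U_{f j}` commutes with every
`U_s`, so the coefficients commute and the Clifford relations make the `T i` anticommute. As `U_{f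
j}` is unitary, `X_j² + Y_j² = 1`, so the symbol preserves the total norm of the derivatives.

Anticommutation leaves only first order cross terms in `‖∑ T i ∂ ξ‖²`, which gives the elliptic
estimate `exists_sum_norm_sq_le`. Self-adjointness follows by Friedrichs regularization: the
multipliers `(1 + ε w)⁻¹` have commutators with `D` bounded uniformly in `ε`, so for `ξ` in the
domain of the adjoint the regularized vectors are bounded in graph norm, hence in the Sobolev norm,
and `ε → 0` puts `ξ` in the domain. The resolvent is compact because it gains the weight `w`, whose
sublevel sets are finite.

For the commutator formula, left and right multiplications commute, so `[ad a, b] = [a, b]`; the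
coefficients `T i` commute with `a°`, so only `∂(a)` survives; and the directions beyond `d` vanish,
since elements of the subtorus are supported where those coordinates are zero. -/

theorem IsSelfAdjoint.inner_eq [CompleteSpace H] (hD : IsSelfAdjoint D) (x y : D.domain) :
    inner ℂ (D x) (y : H) = inner ℂ (x : H) (D y) := by
  have h := LinearPMap.adjoint_isFormalAdjoint hD.dense_domain
  rw [LinearPMap.isSelfAdjoint_def.1 hD] at h
  exact h x y

/-- The cross term is twice the imaginary part of `⟪y, x⟫`, which is real by hypothesis. -/
theorem norm_sub_I_smul_sq {x y : H} (h : inner ℂ y x = inner ℂ x y) :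
    ‖y - Complex.I • x‖ ^ 2 = ‖y‖ ^ 2 + ‖x‖ ^ 2 := by
  have hre : (inner ℂ y x).im = 0 := by
    have := congrArg Complex.im h
    rw [← inner_conj_symm x y, Complex.conj_im] at this
    linarith
  rw [@norm_sub_sq ℂ, inner_smul_right, norm_smul, Complex.norm_I, one_mul]
  simp [hre]

/-- A self-adjoint operator has a resolvent at `i`. -/
theorem exists_isResolventAt_I [CompleteSpace H] (hD : IsSelfAdjoint D) :
    ∃ R : H →L[ℂ] H, IsResolventAt D Complex.I R := by
  have hsymm := IsSelfAdjoint.inner_eq hD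
  have hclosed : IsClosed (D.graph : Set (H × H)) := hD.isClosed
  have : CompleteSpace D.graph := hclosed.completeSpace_coe
  let L : D.graph →L[ℂ] H :=
    (ContinuousLinearMap.snd ℂ H H - Complex.I • ContinuousLinearMap.fst ℂ H H).comp
      D.graph.subtypeL
  have hL : ∀ p : D.graph, ‖p‖ ≤ ‖L p‖ := by
    rintro ⟨⟨x, y⟩, hp⟩
    obtain ⟨u, rfl, rfl⟩ := (LinearPMap.mem_graph_iff D).1 hp
    have h := norm_sub_I_smul_sq (hsymm u u)
    change max ‖(u : H)‖ ‖D u‖ ≤ ‖D u - Complex.I • (u : H)‖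
    refine max_le ?_ ?_ <;> refine le_of_sq_le_sq ?_ (norm_nonneg _) <;> rw [h] <;>
    nlinarith [norm_nonneg (u : H), norm_nonneg (D u)]
  have hanti : AntilipschitzWith 1 L := L.antilipschitz_of_bound fun p => by simpa using hL p
  -- The graph is complete and `L` is bounded below, so the range is closed. A vector `y` orthogonal
  -- to it lies in the domain of the adjoint with `D* y = -i y`, which self-adjointness allows only
  -- for `y = 0`.
  have hrange : (LinearMap.range (L : D.graph →ₗ[ℂ] H)) = ⊤ := by
    have hcl : IsClosed (LinearMap.range (L : D.graph →ₗ[ℂ] H) : Set H) := by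
      rw [LinearMap.coe_range]
      exact hanti.isClosed_range L.uniformContinuous
    have : CompleteSpace (LinearMap.range (L : D.graph →ₗ[ℂ] H)) := hcl.completeSpace_coe
    rw [← Submodule.orthogonal_eq_bot_iff, Submodule.eq_bot_iff]
    intro y hy
    have horth : ∀ x : D.domain, inner ℂ ((-Complex.I) • y) (x : H) = inner ℂ y (D x) := by
      intro x
      have h0 : inner ℂ (D x - Complex.I • (x : H)) y = 0 :=
        hy _ ⟨⟨((x : H), D x), D.mem_graph x⟩, rfl⟩
      rw [← inner_conj_symm, map_eq_zero, inner_sub_right, inner_smul_right, sub_eq_zero] at h0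
      rw [h0, inner_smul_left]
      simp
    have hmem : y ∈ (D.adjoint).domain := LinearPMap.mem_adjoint_domain_of_exists _ ⟨_, horth⟩
    have hval := LinearPMap.adjoint_apply_eq hD.dense_domain ⟨y, hmem⟩ horth
    have hform := LinearPMap.adjoint_isFormalAdjoint hD.dense_domain
    rw [LinearPMap.isSelfAdjoint_def.1 hD] at hform
    -- The domain membership depends on the operator, so the identity `D* = D` is used by
    -- substitution in a general `E`.
    have hsa : ∀ (E : H →ₗ.[ℂ] H) (_ : E = D) (hy : y ∈ E.domain), E ⟨y, hy⟩ = (-Complex.I) • y →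
        y = 0 := by
      rintro E rfl hy' hE
      have h := hform ⟨y, hy'⟩ ⟨y, hy'⟩
      rw [hE, inner_smul_left, inner_smul_right, map_neg, Complex.conj_I, neg_neg, neg_mul,
        eq_neg_iff_add_eq_zero, ← two_mul, mul_eq_zero, mul_eq_zero] at h
      simpa using h
    exact hsa _ (LinearPMap.isSelfAdjoint_def.1 hD) hmem hval
  let e : D.graph ≃ₗ[ℂ] H := LinearEquiv.ofBijective (L : D.graph →ₗ[ℂ] H)
    ⟨hanti.injective, LinearMap.range_eq_top.1 hrange⟩
  have he : ∀ p : D.graph, e p = p.1.2 - Complex.I • p.1.1 := fun p => rfl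
  let R : H →L[ℂ] H := LinearMap.mkContinuous
    ((LinearMap.fst ℂ H H) ∘ₗ D.graph.subtype ∘ₗ (e.symm : H →ₗ[ℂ] D.graph)) 1 fun x => by
      obtain ⟨p, rfl⟩ := e.surjective x
      have h : ‖p.1.1‖ ≤ ‖e p‖ := (norm_fst_le p.1).trans (hL p)
      simpa using h
  have hR : ∀ p : D.graph, R (e p) = p.1.1 := fun p => by
    change (e.symm (e p)).1.1 = _
    rw [e.symm_apply_apply]
  refine ⟨R, fun η => ?_, fun ξ => hR ⟨(ξ, D ξ), D.mem_graph ξ⟩⟩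
  obtain ⟨⟨⟨x, y⟩, hp⟩, rfl⟩ := e.surjective η
  obtain ⟨u, rfl, rfl⟩ := (LinearPMap.mem_graph_iff D).1 hp
  have h1 := hR ⟨((u : H), D u), hp⟩
  have hu : R (e ⟨((u : H), D u), hp⟩) ∈ D.domain := h1.symm ▸ u.2
  have h2 : D ⟨_, hu⟩ = D u := congrArg D (Subtype.ext h1)
  exact ⟨hu, by rw [h2, h1, he]⟩

theorem isSelfAdjoint_of_adjoint_domain_le [CompleteSpace H] (hd : Dense (D.domain : Set H))
    (hsymm : ∀ x y : D.domain, inner ℂ (D x) (y : H) = inner ℂ (x : H) (D y))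
    (h : ∀ ξ ∈ D.adjoint.domain, ξ ∈ D.domain) : IsSelfAdjoint D := by
  have hle : D ≤ D.adjoint :=
    LinearPMap.IsFormalAdjoint.le_adjoint hd fun x y => hsymm x y
  exact (LinearPMap.eq_of_le_of_domain_eq hle (le_antisymm hle.1 h)).symm

/-- Friedrichs' argument by duality: for `η` in the domain, `⟪D P ξ, η⟫ = ⟪ξ, P D η⟫ = ⟪D* ξ, P η⟫ +
⟪ξ, [P, D] η⟫`. Only the commutator bound `K` enters, so the estimate is uniform over a family of
regularizers sharing it. -/
theorem norm_apply_regularization_le [CompleteSpace H] (hd : Dense (D.domain : Set H))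
    (hsymm : ∀ x y : D.domain, inner ℂ (D x) (y : H) = inner ℂ (x : H) (D y))
    (P : H →L[ℂ] H) (hPsymm : ∀ x y, inner ℂ (P x) y = inner ℂ x (P y)) (hP : ∀ x, ‖P x‖ ≤ ‖x‖)
    (hPD : ∀ x, P x ∈ D.domain) {K : ℝ} (hK0 : 0 ≤ K)
    (hK : ∀ η : D.domain, ‖P (D η) - D ⟨P η, hPD η⟩‖ ≤ K * ‖(η : H)‖) (ξ : D.adjoint.domain) :
    ‖D ⟨P ξ, hPD ξ⟩‖ ≤ ‖D.adjoint ξ‖ + K * ‖(ξ : H)‖ := by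
  have hform := LinearPMap.adjoint_isFormalAdjoint hd
  set y := D ⟨P ξ, hPD ξ⟩ with hy
  have key : ∀ η : H, ‖inner ℂ y η‖ ≤ (‖D.adjoint ξ‖ + K * ‖(ξ : H)‖) * ‖η‖ := by
    intro η
    refine hd.induction (P := fun η => ‖inner ℂ y η‖ ≤ (‖D.adjoint ξ‖ + K * ‖(ξ : H)‖) * ‖η‖)
      ?_ (isClosed_le (by fun_prop) (by fun_prop)) η
    intro η hη
    lift η to D.domain using hη
    have h1 : inner ℂ y (η : H) =
        inner ℂ (D.adjoint ξ) (P η) + inner ℂ (ξ : H) (P (D η) - D ⟨P η, hPD η⟩) := by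
      rw [hy, hsymm, hPsymm, inner_sub_right, hform ξ ⟨P η, hPD η⟩]
      simp
    calc ‖inner ℂ y (η : H)‖ ≤ ‖D.adjoint ξ‖ * ‖P η‖ + ‖(ξ : H)‖ * ‖P (D η) - D ⟨P η, hPD η⟩‖ := by
          rw [h1]
          exact (norm_add_le _ _).trans
            (add_le_add (norm_inner_le_norm _ _) (norm_inner_le_norm _ _))
      _ ≤ ‖D.adjoint ξ‖ * ‖(η : H)‖ + ‖(ξ : H)‖ * (K * ‖(η : H)‖) := by
          gcongr
          exacts [hP _, hK η]
      _ = _ := by ring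
  -- Testing against `y` itself and dividing by its norm turns the bound on the functional into a
  -- bound on `y`.
  have h := key y
  rw [inner_self_eq_norm_sq_to_K] at h
  rcases eq_or_ne ‖y‖ 0 with h0 | h0
  · rw [h0]
    positivity
  · have : 0 < ‖y‖ := lt_of_le_of_ne (norm_nonneg _) h0.symm
    simp at h
    nlinarith

end Unbounded

/-! ### Multiplication operators and weighted translations -/

section Multiplication

variable {ι E : Type*} [NormedAddCommGroup E]

theorem norm_le_of_forall_norm_le {F : Type*} [NormedAddCommGroup F] (e : ι ≃ ι) {M : ℝ}
    (hM : 0 ≤ M) (f : L2 ι E) (g : L2 ι F) (h : ∀ i, ‖f i‖ ≤ M * ‖g (e i)‖) : ‖f‖ ≤ M * ‖g‖ := by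
  refine le_of_sq_le_sq ?_ (by positivity)
  rw [norm_sq_eq, mul_pow, norm_sq_eq, ← tsum_mul_left, ← e.tsum_eq (fun i => M ^ 2 * ‖g i‖ ^ 2)]
  refine Summable.tsum_le_tsum (fun i => ?_) (summable_norm_sq f)
    ((e.summable_iff (f := fun i => M ^ 2 * ‖g i‖ ^ 2)).2 ((summable_norm_sq g).mul_left (M ^ 2)))
  calc ‖f i‖ ^ 2 ≤ (M * ‖g (e i)‖) ^ 2 := by gcongr; exact h i
    _ = M ^ 2 * ‖g (e i)‖ ^ 2 := by ring

theorem L2_sum_apply {κ : Type*} (S : Finset κ) (g : κ → L2 ι E) (i : ι) :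
    (∑ a ∈ S, g a) i = ∑ a ∈ S, g a i := by
  rw [lp.coeFn_sum, Finset.sum_apply]

variable [NormedSpace ℂ E]

/-- Multiplication by a bounded function. -/
def mulOp (E : Type*) [NormedAddCommGroup E] [NormedSpace ℂ E] (φ : ι → ℂ) (M : ℝ) (hM : 0 ≤ M)
    (hφ : ∀ i, ‖φ i‖ ≤ M) : L2 ι E →L[ℂ] L2 ι E :=
  pointwise (Equiv.refl ι) (fun i => φ i • LinearMap.id) M hM fun i x => by
    simpa [norm_smul] using mul_le_mul_of_nonneg_right (hφ i) (norm_nonneg x)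

@[simp]
theorem mulOp_apply (φ : ι → ℂ) (M : ℝ) (hM : 0 ≤ M) (hφ : ∀ i, ‖φ i‖ ≤ M) (ξ : L2 ι E) (i : ι) :
    mulOp E φ M hM hφ ξ i = φ i • ξ i := rfl

theorem norm_mulOp_apply_le (φ : ι → ℂ) (M : ℝ) (hM : 0 ≤ M) (hφ : ∀ i, ‖φ i‖ ≤ M) (ξ : L2 ι E) :
    ‖mulOp E φ M hM hφ ξ‖ ≤ M * ‖ξ‖ :=
  norm_le_of_forall_norm_le (Equiv.refl ι) hM _ _ fun i => by
    simpa [norm_smul] using mul_le_mul_of_nonneg_right (hφ i) (norm_nonneg (ξ i))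

variable {C : Type*} [NormedAddCommGroup C] [InnerProductSpace ℂ C] [FiniteDimensional ℂ C]

theorem tensorOp_eq (a : L2 ι ℂ →L[ℂ] L2 ι ℂ) (t : C →L[ℂ] C) (ξ : L2 ι C) :
    tensorOp a t ξ = ∑ i, tmulRight ι (t (stdOrthonormalBasis ℂ C i))
      (a (slice ι (stdOrthonormalBasis ℂ C i) ξ)) := by
  simp [tensorOp]

/-- For such operators the orthonormal basis used to define `tensorOp` disappears, which allows
pointwise computations. -/
theorem tensorOp_apply_of_forall {a : L2 ι ℂ →L[ℂ] L2 ι ℂ} {u : ι → ℂ} {e : ι → ι}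
    (ha : ∀ ξ i, a ξ i = u i * ξ (e i)) (t : C →L[ℂ] C) (ξ : L2 ι C) (i : ι) :
    tensorOp a t ξ i = u i • t (ξ (e i)) := by
  rw [tensorOp_eq, L2_sum_apply]
  simp only [tmulRight_apply, ha, slice_apply, mul_smul]
  rw [← Finset.smul_sum]
  congr 1
  conv_rhs => rw [← (stdOrthonormalBasis ℂ C).sum_repr' (ξ (e i)), map_sum]
  simp

theorem tensorOp_mul (a b : L2 ι ℂ →L[ℂ] L2 ι ℂ) (t u : C →L[ℂ] C) :
    tensorOp a t * tensorOp b u = tensorOp (a * b) (t * u) :=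
  ext_tmulRight fun v ξ => by simp [tensorOp_tmulRight]

theorem star_tensorOp (a : L2 ι ℂ →L[ℂ] L2 ι ℂ) (t : C →L[ℂ] C) :
    star (tensorOp a t) = tensorOp (star a) (star t) := by
  symm
  rw [ContinuousLinearMap.star_eq_adjoint, ContinuousLinearMap.star_eq_adjoint,
    ContinuousLinearMap.star_eq_adjoint, ContinuousLinearMap.eq_adjoint_iff]
  intro x y
  rw [← sum_tmulRight_slice x, ← sum_tmulRight_slice y]
  simp only [map_sum, sum_inner, inner_sum, tensorOp_tmulRight]
  refine Finset.sum_congr rfl fun i _ => Finset.sum_congr rfl fun j _ => ?_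
  simp [inner_tmulRight_left, slice_tmulRight, ContinuousLinearMap.adjoint_inner_left]

@[simp]
theorem tensorOpBilin_apply (a : L2 ι ℂ →L[ℂ] L2 ι ℂ) (t : C →L[ℂ] C) :
    tensorOpBilin ι C a t = tensorOp a t := rfl

theorem tensorOp_add_left (a b : L2 ι ℂ →L[ℂ] L2 ι ℂ) (t : C →L[ℂ] C) :
    tensorOp (a + b) t = tensorOp a t + tensorOp b t := by
  simp [← tensorOpBilin_apply]

theorem tensorOp_sub_left (a b : L2 ι ℂ →L[ℂ] L2 ι ℂ) (t : C →L[ℂ] C) :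
    tensorOp (a - b) t = tensorOp a t - tensorOp b t := by
  simp [← tensorOpBilin_apply]

theorem tensorOp_neg_left (a : L2 ι ℂ →L[ℂ] L2 ι ℂ) (t : C →L[ℂ] C) :
    tensorOp (-a) t = -tensorOp a t := by
  simp [← tensorOpBilin_apply]

theorem tensorOp_neg_right (a : L2 ι ℂ →L[ℂ] L2 ι ℂ) (t : C →L[ℂ] C) :
    tensorOp a (-t) = -tensorOp a t := by
  simp [← tensorOpBilin_apply]

theorem tensorOp_smul_left (z : ℂ) (a : L2 ι ℂ →L[ℂ] L2 ι ℂ) (t : C →L[ℂ] C) :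
    tensorOp (z • a) t = z • tensorOp a t := by
  simp [← tensorOpBilin_apply]

theorem tensorOp_zero_left (t : C →L[ℂ] C) :
    tensorOp (0 : L2 ι ℂ →L[ℂ] L2 ι ℂ) t = 0 := by
  simp [← tensorOpBilin_apply]

end Multiplication

/-! ### Coordinates and weights -/

section Weights

variable {N : ℕ} {k : Fin N → ℕ∞}

/-- Only coordinates in `ZMod 0 = ℤ` are retained, and there the integer representative is additive;
it would not be so modulo a finite `k j`. -/
theorem infCoord_add (m n : Zk k) (j : Fin N) :
    infCoord (m + n) j = infCoord m j + infCoord n j := by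
  unfold infCoord intCoord
  split_ifs with h
  · exact ZMod.cast_add (by simp [h]) (m j) (n j)
  · rfl

theorem infCoord_zero (j : Fin N) : infCoord (0 : Zk k) j = 0 := by
  have := infCoord_add (0 : Zk k) 0 j
  simpa using this

theorem infCoord_neg (m : Zk k) (j : Fin N) : infCoord (-m) j = -infCoord m j := by
  have := infCoord_add (-m) m j
  rw [neg_add_cancel, infCoord_zero] at this
  linarith

theorem infCoord_single_ne {i j : Fin N} (h : i ≠ j) (x : ZMod (k i).toNat) :
    infCoord (Pi.single i x : Zk k) j = 0 := by
  simp [infCoord, intCoord, Pi.single_eq_of_ne h.symm]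

theorem pairing_self (m : Zk k) : pairing m m = ∑ j, (infCoord m j : ℝ) ^ 2 := by
  rw [pairing, Finset.sum_filter]
  refine Finset.sum_congr rfl fun j _ => ?_
  unfold infCoord
  split_ifs <;> simp [sq]

theorem pairing_self_nonneg (m : Zk k) : 0 ≤ pairing m m := by
  rw [pairing_self]
  positivity

/-- The weight `√(1 + ⟨m, m⟩)`. -/
def weight (m : Zk k) : ℝ := √(1 + pairing m m)

theorem weight_sq (m : Zk k) : weight m ^ 2 = 1 + pairing m m :=
  Real.sq_sqrt (by linarith [pairing_self_nonneg m])

theorem one_le_weight (m : Zk k) : 1 ≤ weight m :=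
  Real.one_le_sqrt.2 (by linarith [pairing_self_nonneg m])

theorem weight_pos (m : Zk k) : 0 < weight m := zero_lt_one.trans_le (one_le_weight m)

theorem abs_infCoord_le_weight (m : Zk k) (j : Fin N) : |(infCoord m j : ℝ)| ≤ weight m := by
  refine Real.abs_le_sqrt ?_
  rw [pairing_self]
  have := Finset.single_le_sum (s := Finset.univ) (f := fun i => (infCoord m i : ℝ) ^ 2)
    (fun i _ => sq_nonneg _) (Finset.mem_univ j)
  linarith

/-- The `ℓ¹`-length of the unbounded coordinates. -/
def length (m : Zk k) : ℝ := ∑ j, |(infCoord m j : ℝ)|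

theorem length_nonneg (m : Zk k) : 0 ≤ length m := by
  unfold length
  positivity

/-- The difference of the squared weights is `∑ m_j (n_j + (n - m)_j)`. Each coordinate is at most
the corresponding weight, so dividing by the sum of the weights leaves the length of `m`. -/
theorem abs_weight_sub_le (m n : Zk k) : |weight n - weight (n - m)| ≤ length m := by
  have hpos : 0 < weight n + weight (n - m) := add_pos (weight_pos n) (weight_pos _)
  have h : (weight n - weight (n - m)) * (weight n + weight (n - m)) =
      ∑ j, (infCoord m j : ℝ) * (infCoord n j + infCoord (n - m) j) := by
    rw [show (weight n - weight (n - m)) * (weight n + weight (n - m)) =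
      weight n ^ 2 - weight (n - m) ^ 2 by ring, weight_sq, weight_sq, pairing_self, pairing_self,
      add_sub_add_left_eq_sub, ← Finset.sum_sub_distrib]
    refine Finset.sum_congr rfl fun j _ => ?_
    have : (infCoord n j : ℝ) = infCoord (n - m) j + infCoord m j := by
      rw [← Int.cast_add, ← infCoord_add, sub_add_cancel]
    rw [this]
    ring
  refine le_of_mul_le_mul_right ?_ hpos
  rw [← abs_of_pos hpos, ← abs_mul, h, abs_of_pos hpos, length, Finset.sum_mul]
  refine (Finset.abs_sum_le_sum_abs _ _).trans (Finset.sum_le_sum fun j _ => ?_)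
  rw [abs_mul]
  gcongr
  exact (abs_add_le _ _).trans
    (add_le_add (abs_infCoord_le_weight _ _) (abs_infCoord_le_weight _ _))

theorem weight_le_mul (m n : Zk k) : weight n ≤ (length m + 1) * weight (n - m) := by
  have h1 := (abs_le.1 (abs_weight_sub_le m n)).2
  nlinarith [one_le_weight (n - m), length_nonneg m]

/-- The decaying multiplier `1 / (1 + ε w)`. -/
def decay (k : Fin N → ℕ∞) (ε : ℝ) (m : Zk k) : ℝ := (1 + ε * weight m)⁻¹

variable {ε : ℝ}

theorem decay_pos (hε : 0 < ε) (m : Zk k) : 0 < decay k ε m :=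
  inv_pos.2 (by have := weight_pos m; positivity)

theorem decay_le_one (hε : 0 < ε) (m : Zk k) : decay k ε m ≤ 1 :=
  inv_le_one_of_one_le₀ (by have := weight_pos m; nlinarith)

theorem weight_mul_decay_le (hε : 0 < ε) (m : Zk k) : weight m * decay k ε m ≤ ε⁻¹ := by
  have hw := weight_pos m
  rw [decay, ← div_eq_mul_inv, div_le_iff₀ (by positivity), mul_add, inv_mul_cancel_left₀ hε.ne']
  have : 0 < ε⁻¹ := inv_pos.2 hε
  linarith

/-- The difference of the two decays carries a factor `ε`, which pays for the weight since `ε w / (1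
+ ε w) ≤ 1`. The bound therefore does not depend on `ε`. -/
theorem abs_decay_sub_mul_weight_le (hε : 0 < ε) (m n : Zk k) :
    |decay k ε n - decay k ε (n - m)| * weight (n - m) ≤ length m := by
  have hw := weight_pos (n - m)
  have hw' := weight_pos n
  have h : decay k ε n - decay k ε (n - m) =
      ε * (weight (n - m) - weight n) * decay k ε n * decay k ε (n - m) := by
    unfold decay
    field_simp
    ring
  have h1 : ε * (weight (n - m) * decay k ε (n - m)) ≤ 1 := by
    have := mul_le_mul_of_nonneg_left (weight_mul_decay_le hε (n - m)) hε.le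
    rwa [mul_inv_cancel₀ hε.ne'] at this
  have h2 := abs_weight_sub_le m n
  rw [abs_sub_comm] at h2
  have hd := decay_pos hε n
  have hd1 := decay_le_one hε n
  have hd' := decay_pos hε (n - m)
  rw [h, abs_mul, abs_mul, abs_mul, abs_of_pos hε, abs_of_pos hd, abs_of_pos hd']
  calc ε * |weight (n - m) - weight n| * decay k ε n * decay k ε (n - m) * weight (n - m)
      = |weight (n - m) - weight n| * decay k ε n * (ε * (weight (n - m) * decay k ε (n - m))) := by
        ring
    _ ≤ length m * 1 * 1 := by
        have := length_nonneg m
        gcongr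
    _ = length m := by ring

end Weights

/-! ### Vector-valued Sobolev spaces -/

section Sobolev

variable {N : ℕ} {k : Fin N → ℕ∞} {E : Type*} [NormedAddCommGroup E] [NormedSpace ℂ E]

theorem mem_sobolev_iff {ξ : L2 (Zk k) E} :
    ξ ∈ sobolev k E ↔ Summable fun m => weight m ^ 2 * ‖ξ m‖ ^ 2 := by
  change Memℓp (E := fun _ : Zk k => E) (fun m => ((√(1 + pairing m m) : ℝ) : ℂ) • ξ m) 2 ↔ _
  rw [memℓp_two_iff]
  refine iff_of_eq (congrArg Summable (funext fun m => ?_))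
  rw [norm_smul, mul_pow, Complex.norm_real, Real.norm_eq_abs, sq_abs]
  rfl

theorem memℓp_deriv (j : Fin N) (ξ : sobolev k E) :
    Memℓp (E := fun _ : Zk k => E) (fun m => (Complex.I * infCoord m j) • ξ.1 m) 2 := by
  rw [memℓp_two_iff]
  refine Summable.of_nonneg_of_le (fun _ => by positivity) (fun m => ?_) (mem_sobolev_iff.1 ξ.2)
  rw [norm_smul, mul_pow, norm_mul, Complex.norm_I, one_mul, Complex.norm_intCast]
  gcongr
  exact abs_infCoord_le_weight m j

/-- The derivation `∂_j` on vector-valued functions. -/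
def deriv (j : Fin N) : sobolev k E →ₗ[ℂ] L2 (Zk k) E where
  toFun ξ := ⟨fun m => (Complex.I * infCoord m j) • ξ.1 m, memℓp_deriv j ξ⟩
  map_add' ξ η := by ext m; exact smul_add _ _ _
  map_smul' c ξ := by ext m; exact smul_comm _ _ _

@[simp]
theorem deriv_apply (j : Fin N) (ξ : sobolev k E) (m : Zk k) :
    deriv j ξ m = (Complex.I * infCoord m j) • ξ.1 m := rfl

theorem norm_deriv_apply_sq (j : Fin N) (ξ : sobolev k E) (m : Zk k) :
    ‖deriv j ξ m‖ ^ 2 = (infCoord m j : ℝ) ^ 2 * ‖ξ.1 m‖ ^ 2 := by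
  rw [deriv_apply, norm_smul, mul_pow, norm_mul, Complex.norm_I, one_mul, Complex.norm_intCast,
    sq_abs]

/-- This is `w² = 1 + ∑ m_j²`, summed: control of all derivatives amounts to control of the Sobolev
norm. -/
theorem tsum_weight_sq_mul (ξ : sobolev k E) :
    ∑' m, weight m ^ 2 * ‖ξ.1 m‖ ^ 2 = ‖ξ.1‖ ^ 2 + ∑ j, ‖deriv j ξ‖ ^ 2 := by
  have h : ∀ m, weight m ^ 2 * ‖ξ.1 m‖ ^ 2 = ‖ξ.1 m‖ ^ 2 + ∑ j, ‖deriv j ξ m‖ ^ 2 := fun m => by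
    simp only [weight_sq, pairing_self, norm_deriv_apply_sq, add_mul, one_mul, Finset.sum_mul]
  simp only [h, norm_sq_eq]
  rw [Summable.tsum_add (summable_norm_sq _) (summable_sum fun j _ => summable_norm_sq _),
    Summable.tsum_finsetSum fun j _ => summable_norm_sq _]

theorem deriv_eq_zero {j : Fin N} (hj : k j ≠ ⊤) (ξ : sobolev k E) : deriv j ξ = 0 := by
  ext m
  simp [infCoord, hj]

theorem single_mem_sobolev [DecidableEq (Zk k)] (m : Zk k) (x : E) :
    lp.single 2 m x ∈ sobolev k E := by
  rw [mem_sobolev_iff]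
  refine summable_of_ne_finset_zero (s := {m}) fun n hn => ?_
  rw [lp.single_apply_ne _ _ _ (by simpa using hn)]
  simp

theorem dense_sobolev : Dense (sobolev k E : Set (L2 (Zk k) E)) := by
  classical
  intro ξ
  refine mem_closure_of_tendsto (lp.hasSum_single (by simp) ξ) (Eventually.of_forall fun S => ?_)
  exact sum_mem fun m _ => single_mem_sobolev m _

/-- Multiplication by `decay k ε`. -/
def decayOp (k : Fin N → ℕ∞) (E : Type*) [NormedAddCommGroup E] [NormedSpace ℂ E] {ε : ℝ}
    (hε : 0 < ε) : L2 (Zk k) E →L[ℂ] L2 (Zk k) E :=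
  mulOp E (fun m => (decay k ε m : ℂ)) 1 zero_le_one fun m => by
    rw [Complex.norm_real, Real.norm_eq_abs, abs_of_pos (decay_pos hε m)]
    exact decay_le_one hε m

variable {ε : ℝ} (hε : 0 < ε)

@[simp]
theorem decayOp_apply (ξ : L2 (Zk k) E) (m : Zk k) :
    decayOp k E hε ξ m = (decay k ε m : ℂ) • ξ m := rfl

theorem norm_decayOp_apply_le (ξ : L2 (Zk k) E) : ‖decayOp k E hε ξ‖ ≤ ‖ξ‖ :=
  (norm_mulOp_apply_le _ 1 zero_le_one _ ξ).trans_eq (one_mul _)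

theorem norm_decayOp_coe (ξ : L2 (Zk k) E) (m : Zk k) :
    ‖decayOp k E hε ξ m‖ = decay k ε m * ‖ξ m‖ := by
  rw [decayOp_apply, norm_smul, Complex.norm_real, Real.norm_eq_abs, abs_of_pos (decay_pos hε m)]

theorem decayOp_mem_sobolev (ξ : L2 (Zk k) E) : decayOp k E hε ξ ∈ sobolev k E := by
  rw [mem_sobolev_iff]
  refine Summable.of_nonneg_of_le (fun _ => by positivity) (fun m => ?_)
    ((summable_norm_sq ξ).mul_left (ε⁻¹ ^ 2))
  rw [norm_decayOp_coe, ← mul_pow, ← mul_assoc, mul_pow]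
  gcongr
  · have := weight_pos m
    have := decay_pos hε m
    positivity
  · exact weight_mul_decay_le hε m

/-- `decayOp`, with values in the Sobolev space. -/
def regularize (ξ : L2 (Zk k) E) : sobolev k E := ⟨decayOp k E hε ξ, decayOp_mem_sobolev hε ξ⟩

@[simp]
theorem coe_regularize (ξ : L2 (Zk k) E) :
    (regularize hε ξ : L2 (Zk k) E) = decayOp k E hε ξ := rfl

theorem deriv_regularize (j : Fin N) (ξ : sobolev k E) :
    deriv j (regularize hε (ξ : L2 (Zk k) E)) = decayOp k E hε (deriv j ξ) := by
  ext m
  rw [decayOp_apply, deriv_apply, deriv_apply, coe_regularize, decayOp_apply, smul_comm]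

/-- Weighted bounds which are uniform in the regularization pass to the limit. -/
theorem mem_sobolev_of_decayOp_le {ξ : L2 (Zk k) E} {K : ℝ}
    (h : ∀ (ε : ℝ) (hε : 0 < ε),
      ∑ j, ‖deriv j (regularize hε ξ)‖ ^ 2 ≤ K) : ξ ∈ sobolev k E := by
  rw [mem_sobolev_iff]
  refine summable_of_sum_le (c := ‖ξ‖ ^ 2 + K) (fun _ => by positivity) fun S => ?_
  -- On a finite set the limit `ε → 0` is termwise; the uniform bound then passes to every finite
  -- partial sum.
  have hlim : Tendsto (fun ε : ℝ => ∑ m ∈ S, weight m ^ 2 * (decay k ε m * ‖ξ m‖) ^ 2) (𝓝[>] 0)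
      (𝓝 (∑ m ∈ S, weight m ^ 2 * (1 * ‖ξ m‖) ^ 2)) := by
    refine tendsto_finsetSum _ fun m _ => ?_
    refine Tendsto.const_mul _ (Tendsto.pow (Tendsto.mul_const _ ?_) 2)
    have h1 : ContinuousAt (fun ε : ℝ => decay k ε m) 0 := by
      unfold decay
      refine ContinuousAt.inv₀ (by fun_prop) (by simp)
    have h2 : decay k 0 m = 1 := by simp [decay]
    rw [← h2]
    exact h1.tendsto.mono_left nhdsWithin_le_nhds
  simp only [one_mul] at hlim
  refine le_of_tendsto hlim (eventually_nhdsWithin_of_forall fun ε (hε : 0 < ε) => ?_)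
  have h1 := tsum_weight_sq_mul (regularize hε ξ)
  have h2 := (mem_sobolev_iff.1 (decayOp_mem_sobolev hε ξ)).sum_le_tsum S fun _ _ => by positivity
  have h3 := norm_decayOp_apply_le hε ξ
  simp only [coe_regularize, norm_decayOp_coe] at h1 h2
  have h4 : ‖decayOp k E hε ξ‖ ^ 2 ≤ ‖ξ‖ ^ 2 := by gcongr
  linarith [h ε hε]

end Sobolev

/-! ### Operators compatible with the derivations -/

section Smooth

variable {N : ℕ} {k : Fin N → ℕ∞} {C : Type*} [NormedAddCommGroup C] [InnerProductSpace ℂ C]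

theorem inner_deriv_left (j : Fin N) (ξ η : sobolev k C) :
    inner ℂ (deriv j ξ) (η : L2 (Zk k) C) = -inner ℂ (ξ : L2 (Zk k) C) (deriv j η) := by
  rw [lp.inner_eq_tsum, lp.inner_eq_tsum, ← tsum_neg]
  refine tsum_congr fun m => ?_
  simp [inner_smul_left, inner_smul_right]

/-- Both sides are `∑ m_i m_j ⟪ξ m, η m⟫`. This replaces the commutation of second derivatives,
which need not exist on the Sobolev space. -/
theorem inner_deriv_deriv (i j : Fin N) (ξ η : sobolev k C) :
    inner ℂ (deriv i ξ) (deriv j η) = inner ℂ (deriv j ξ) (deriv i η) := by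
  rw [lp.inner_eq_tsum, lp.inner_eq_tsum]
  refine tsum_congr fun m => ?_
  simp [inner_smul_left, inner_smul_right]
  ring

theorem inner_decayOp_left {ε : ℝ} (hε : 0 < ε) (ξ η : L2 (Zk k) C) :
    inner ℂ (decayOp k C hε ξ) η = inner ℂ ξ (decayOp k C hε η) := by
  rw [lp.inner_eq_tsum, lp.inner_eq_tsum]
  refine tsum_congr fun m => ?_
  rw [decayOp_apply, decayOp_apply, inner_smul_left, inner_smul_right, Complex.conj_ofReal]

variable (T S : L2 (Zk k) C →L[ℂ] L2 (Zk k) C)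

/-- `T` maps the Sobolev space to itself. -/
def PreservesSobolev : Prop := ∀ ξ ∈ sobolev k C, T ξ ∈ sobolev k C

/-- The commutator `[∂_j, T]` is the bounded operator `b`. -/
def HasCommutator (j : Fin N) (T b : L2 (Zk k) C →L[ℂ] L2 (Zk k) C) : Prop :=
  ∀ ξ η : sobolev k C, (η : L2 (Zk k) C) = T ξ → deriv j η = T (deriv j ξ) + b ξ

/-- The commutators of `T ∂_j` with the regularizations `decayOp` are uniformly bounded. -/
def IsRegular : Prop :=
  ∃ K : ℝ, 0 ≤ K ∧ ∀ (ε : ℝ) (hε : 0 < ε) (j : Fin N) (ξ : sobolev k C),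
    ‖decayOp k C hε (T (deriv j ξ)) - T (decayOp k C hε (deriv j ξ))‖ ≤ K * ‖(ξ : L2 (Zk k) C)‖

variable {T S}

theorem PreservesSobolev.add (hT : PreservesSobolev T) (hS : PreservesSobolev S) :
    PreservesSobolev (T + S) := fun ξ hξ => add_mem (hT ξ hξ) (hS ξ hξ)

theorem PreservesSobolev.smul (z : ℂ) (hT : PreservesSobolev T) : PreservesSobolev (z • T) :=
  fun ξ hξ => (sobolev k C).smul_mem z (hT ξ hξ)

theorem PreservesSobolev.zero : PreservesSobolev (0 : L2 (Zk k) C →L[ℂ] L2 (Zk k) C) :=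
  fun _ _ => (sobolev k C).zero_mem

theorem PreservesSobolev.mul (hT : PreservesSobolev T) (hS : PreservesSobolev S) :
    PreservesSobolev (T * S) := fun ξ hξ => hT _ (hS ξ hξ)

variable {j : Fin N} {b c : L2 (Zk k) C →L[ℂ] L2 (Zk k) C}

theorem HasCommutator.zero : HasCommutator j (0 : L2 (Zk k) C →L[ℂ] L2 (Zk k) C) 0 := by
  intro ξ η h
  obtain rfl : η = 0 := Subtype.ext h
  simp

theorem HasCommutator.add (hT : HasCommutator j T b) (hS : HasCommutator j S c)
    (hT' : PreservesSobolev T) (hS' : PreservesSobolev S) : HasCommutator j (T + S) (b + c) := by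
  intro ξ η h
  obtain rfl : η = ⟨T ξ, hT' ξ ξ.2⟩ + ⟨S ξ, hS' ξ ξ.2⟩ := Subtype.ext h
  rw [map_add, hT ξ ⟨T ξ, hT' ξ ξ.2⟩ rfl, hS ξ ⟨S ξ, hS' ξ ξ.2⟩ rfl]
  simp only [add_apply]
  abel

theorem HasCommutator.smul (z : ℂ) (hT : HasCommutator j T b) (hT' : PreservesSobolev T) :
    HasCommutator j (z • T) (z • b) := by
  intro ξ η h
  obtain rfl : η = z • ⟨T ξ, hT' ξ ξ.2⟩ := Subtype.ext h
  rw [map_smul, hT ξ _ rfl]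
  simp

theorem HasCommutator.mul (hT : HasCommutator j T b) (hS : HasCommutator j S c)
    (hS' : PreservesSobolev S) : HasCommutator j (T * S) (T * c + b * S) := by
  intro ξ η h
  rw [hT ⟨S ξ, hS' ξ ξ.2⟩ η h, hS ξ ⟨S ξ, hS' ξ ξ.2⟩ rfl]
  simp [add_assoc]

theorem IsRegular.zero : IsRegular (0 : L2 (Zk k) C →L[ℂ] L2 (Zk k) C) :=
  ⟨0, le_rfl, fun ε hε j ξ => by simp⟩

theorem IsRegular.add (hT : IsRegular T) (hS : IsRegular S) : IsRegular (T + S) := by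
  obtain ⟨K, hK0, hK⟩ := hT
  obtain ⟨L, hL0, hL⟩ := hS
  refine ⟨K + L, by positivity, fun ε hε j ξ => ?_⟩
  simp only [add_apply, map_add, add_sub_add_comm, add_mul]
  exact (norm_add_le _ _).trans (add_le_add (hK ε hε j ξ) (hL ε hε j ξ))

theorem IsRegular.smul (z : ℂ) (hT : IsRegular T) : IsRegular (z • T) := by
  obtain ⟨K, hK0, hK⟩ := hT
  refine ⟨‖z‖ * K, by positivity, fun ε hε j ξ => ?_⟩
  simp only [smul_apply, map_smul, ← smul_sub, norm_smul, mul_assoc]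
  exact mul_le_mul_of_nonneg_left (hK ε hε j ξ) (norm_nonneg z)

/-! ### Weighted translations tensored with a matrix -/

section WeightedTranslation

variable {m : Zk k} {u : Zk k → ℂ} {t : C →L[ℂ] C}

theorem norm_weightedTranslation_apply_le (hu : ∀ n, ‖u n‖ = 1)
    (hT : ∀ ξ n, T ξ n = u n • t (ξ (n - m))) (ξ : L2 (Zk k) C) (n : Zk k) :
    ‖T ξ n‖ ≤ ‖t‖ * ‖ξ (n - m)‖ := by
  rw [hT, norm_smul, hu, one_mul]
  exact t.le_opNorm _

/-- Translation by a fixed `m` changes the weight by at most a constant factor, by `weight_le_mul`.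
-/
theorem preservesSobolev_of_forall_apply (hu : ∀ n, ‖u n‖ = 1)
    (hT : ∀ ξ n, T ξ n = u n • t (ξ (n - m))) : PreservesSobolev T := by
  intro ξ hξ
  rw [mem_sobolev_iff] at hξ ⊢
  refine Summable.of_nonneg_of_le (fun _ => by positivity) (fun n => ?_)
    ((((Equiv.subRight m).summable_iff (f := fun n => weight n ^ 2 * ‖ξ n‖ ^ 2)).2 hξ).mul_left
      (((length m + 1) * ‖t‖) ^ 2))
  have h1 := weight_le_mul m n
  have h2 := norm_weightedTranslation_apply_le hu hT ξ n
  have h3 := weight_pos n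
  calc weight n ^ 2 * ‖T ξ n‖ ^ 2
      ≤ ((length m + 1) * weight (n - m)) ^ 2 * (‖t‖ * ‖ξ (n - m)‖) ^ 2 := by gcongr
    _ = _ := by simp only [Function.comp_apply, Equiv.subRight_apply]; ring

/-- As `n_j = (n - m)_j + m_j`, a translation by `m` is an eigenvector of `[∂_j, ·]` with eigenvalue
`i m_j`. -/
theorem hasCommutator_of_forall_apply (hT : ∀ ξ n, T ξ n = u n • t (ξ (n - m))) (j : Fin N) :
    HasCommutator j T ((Complex.I * infCoord m j) • T) := by
  intro ξ η h
  ext n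
  have hn : (infCoord n j : ℂ) = infCoord (n - m) j + infCoord m j := by
    rw [← Int.cast_add, ← infCoord_add, sub_add_cancel]
  rw [deriv_apply, lp.coeFn_add, Pi.add_apply, hT, h, smul_apply, lp.coeFn_smul, Pi.smul_apply, hT,
    deriv_apply, map_smul, hn, smul_comm (u n), ← add_smul, mul_add]

/-- Commuting the decay past the translation leaves the difference of decays at `n` and `n - m`,
times one coordinate of `n - m`; `abs_decay_sub_mul_weight_le` absorbs that coordinate. -/
theorem isRegular_of_forall_apply (hu : ∀ n, ‖u n‖ = 1)
    (hT : ∀ ξ n, T ξ n = u n • t (ξ (n - m))) : IsRegular T := by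
  refine ⟨length m * ‖t‖, mul_nonneg (length_nonneg m) (norm_nonneg t), fun ε hε j ξ => ?_⟩
  refine norm_le_of_forall_norm_le (Equiv.subRight m)
    (mul_nonneg (length_nonneg m) (norm_nonneg t)) _ _ fun n => ?_
  have h : (decayOp k C hε (T (deriv j ξ)) - T (decayOp k C hε (deriv j ξ))) n =
      (((decay k ε n - decay k ε (n - m) : ℝ) : ℂ) * u n * (Complex.I * infCoord (n - m) j)) •
        t (ξ.1 (n - m)) := by
    rw [lp.coeFn_sub, Pi.sub_apply, decayOp_apply, hT, hT, decayOp_apply, deriv_apply, map_smul,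
      map_smul, map_smul, smul_smul, smul_smul, smul_smul, smul_smul, ← sub_smul]
    congr 1
    push_cast
    ring
  rw [h, norm_smul, norm_mul, norm_mul, norm_mul, hu, Complex.norm_I, one_mul, mul_one,
    Complex.norm_intCast, Complex.norm_real, Real.norm_eq_abs, mul_assoc (length m)]
  refine mul_le_mul ?_ (t.le_opNorm _) (norm_nonneg _) (length_nonneg m)
  exact (mul_le_mul_of_nonneg_left (abs_infCoord_le_weight _ j) (abs_nonneg _)).trans
    (abs_decay_sub_mul_weight_le hε m n)

end WeightedTranslation

end Smooth

/-! ### First order operators of Dirac type -/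

section DiracType

variable {N : ℕ} {k : Fin N → ℕ∞} {C : Type*} [NormedAddCommGroup C] [InnerProductSpace ℂ C]

/-- The operator `∑ i, T i ∂_{s i}`. -/
def principal {I : Type*} [Fintype I] (s : I → Fin N) (T : I → L2 (Zk k) C →L[ℂ] L2 (Zk k) C) :
    sobolev k C →ₗ[ℂ] L2 (Zk k) C :=
  ∑ i, (T i : L2 (Zk k) C →ₗ[ℂ] L2 (Zk k) C) ∘ₗ deriv (s i)

variable {I : Type*} [Fintype I] {s : I → Fin N} {T : I → L2 (Zk k) C →L[ℂ] L2 (Zk k) C}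

theorem principal_apply (ξ : sobolev k C) : principal s T ξ = ∑ i, T i (deriv (s i) ξ) := by
  simp [principal]

variable [FiniteDimensional ℂ C]

/-- The operators `T i` are the symbol of the first order operator `∑ i, T i ∂_{s i}` of Dirac
type. -/
structure IsDiracSymbol (s : I → Fin N)
    (T : I → L2 (Zk k) C →L[ℂ] L2 (Zk k) C) : Prop where
  preserves : ∀ i, PreservesSobolev (T i)
  exists_commutator : ∀ i j, ∃ b, HasCommutator j (T i) b
  commute : ∀ i, HasCommutator (s i) (T i) 0
  regular : ∀ i, IsRegular (T i)
  skew : ∀ i, star (T i) = -T i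
  anticomm : ∀ i l, i ≠ l → T i * T l = -(T l * T i)
  sum_norm_sq : ∀ ξ : sobolev k C,
    ∑ i, ‖T i (deriv (s i) ξ)‖ ^ 2 = ∑ j, ‖deriv j ξ‖ ^ 2

theorem inner_skew {A : L2 (Zk k) C →L[ℂ] L2 (Zk k) C} (hA : star A = -A) (x y : L2 (Zk k) C) :
    inner ℂ (A x) y = -inner ℂ x (A y) := by
  rw [← ContinuousLinearMap.adjoint_inner_right, ← ContinuousLinearMap.star_eq_adjoint, hA,
    neg_apply, inner_neg_right]

namespace IsDiracSymbol

variable (hT : IsDiracSymbol s T)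

include hT

/-- Each term is a product of a skew bounded operator and a skew derivative which commute with each
other, hence symmetric. -/
theorem inner_principal (ξ η : sobolev k C) :
    inner ℂ (principal s T ξ) (η : L2 (Zk k) C) = inner ℂ (ξ : L2 (Zk k) C) (principal s T η) := by
  rw [principal_apply, principal_apply, sum_inner, inner_sum]
  refine Finset.sum_congr rfl fun i _ => ?_
  have h := hT.commute i η ⟨T i η, hT.preserves i _ η.2⟩ rfl
  rw [zero_apply, add_zero] at h
  rw [inner_skew (hT.skew i), ← h]
  exact neg_eq_iff_eq_neg.2 (inner_deriv_left (s i) ξ ⟨T i η, hT.preserves i _ η.2⟩)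

/-- With `T = T i * T l`, skewness and anticommutation make twice the real part equal to `⟪∂_l ξ, T
∂_i ξ⟫ - ⟪∂_i ξ, T ∂_l ξ⟫`. Moving the derivatives past `T` cancels the second order terms and
leaves bounded commutators, so one derivative is gained over Cauchy–Schwarz. -/
theorem abs_re_inner_le {i l : I} (hil : i ≠ l) : ∃ K : ℝ, 0 ≤ K ∧ ∀ ξ : sobolev k C,
    |(inner ℂ (T i (deriv (s i) ξ)) (T l (deriv (s l) ξ))).re| ≤
      K * ((‖deriv (s i) ξ‖ + ‖deriv (s l) ξ‖) * ‖(ξ : L2 (Zk k) C)‖) := by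
  obtain ⟨a, ha⟩ : ∃ b, HasCommutator (s i) (T i * T l) b := by
    obtain ⟨b, hb⟩ := hT.exists_commutator i (s i)
    obtain ⟨c, hc⟩ := hT.exists_commutator l (s i)
    exact ⟨_, hb.mul hc (hT.preserves l)⟩
  obtain ⟨b, hb⟩ : ∃ b, HasCommutator (s l) (T i * T l) b := by
    obtain ⟨b, hb⟩ := hT.exists_commutator i (s l)
    obtain ⟨c, hc⟩ := hT.exists_commutator l (s l)
    exact ⟨_, hb.mul hc (hT.preserves l)⟩
  refine ⟨‖a‖ + ‖b‖, by positivity, fun ξ => ?_⟩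
  set x := T i (deriv (s i) ξ) with hx
  set y := T l (deriv (s l) ξ) with hy
  let η : sobolev k C := ⟨(T i * T l) ξ, (hT.preserves i).mul (hT.preserves l) _ ξ.2⟩
  have h1 : inner ℂ x y = -inner ℂ (deriv (s i) ξ) ((T i * T l) (deriv (s l) ξ)) := by
    rw [hx, inner_skew (hT.skew i)]
    rfl
  have h2 : inner ℂ y x = inner ℂ (deriv (s l) ξ) ((T i * T l) (deriv (s i) ξ)) := by
    rw [hy, inner_skew (hT.skew l), hT.anticomm i l hil, neg_apply, inner_neg_right]
    rfl
  have h3 : inner ℂ x y + inner ℂ y x =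
      inner ℂ (deriv (s i) ξ) (b ξ) - inner ℂ (deriv (s l) ξ) (a ξ) := by
    rw [h1, h2, eq_sub_of_add_eq (hb ξ η rfl).symm, eq_sub_of_add_eq (ha ξ η rfl).symm,
      inner_sub_right, inner_sub_right, inner_deriv_deriv (s l) (s i) ξ η]
    ring
  have h4 : 2 * |(inner ℂ x y).re| = ‖inner ℂ x y + inner ℂ y x‖ := by
    rw [← inner_conj_symm y x, Complex.add_conj, Complex.norm_real, Real.norm_eq_abs, abs_mul,
      abs_two]
  have h5 : ‖inner ℂ x y + inner ℂ y x‖ ≤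
      ‖deriv (s i) ξ‖ * (‖b‖ * ‖(ξ : L2 (Zk k) C)‖) +
        ‖deriv (s l) ξ‖ * (‖a‖ * ‖(ξ : L2 (Zk k) C)‖) := by
    rw [h3]
    refine (norm_sub_le _ _).trans (add_le_add ?_ ?_) <;>
    refine (norm_inner_le_norm _ _).trans (mul_le_mul_of_nonneg_left ?_ (norm_nonneg _)) <;>
    exact ContinuousLinearMap.le_opNorm _ _
  have h6 : 0 ≤ ‖deriv (s i) ξ‖ * (‖a‖ * ‖(ξ : L2 (Zk k) C)‖) := by positivity
  have h7 : 0 ≤ ‖deriv (s l) ξ‖ * (‖b‖ * ‖(ξ : L2 (Zk k) C)‖) := by positivity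
  nlinarith [abs_nonneg (inner ℂ x y).re]

/-- The elliptic estimate. -/
theorem exists_sum_norm_sq_le : ∃ K : ℝ, 0 ≤ K ∧ ∀ ξ : sobolev k C,
    ∑ j, ‖deriv j ξ‖ ^ 2 ≤ 2 * ‖principal s T ξ‖ ^ 2 + K * ‖(ξ : L2 (Zk k) C)‖ ^ 2 := by
  classical
  have hK : ∀ p : I × I, ∃ K : ℝ, 0 ≤ K ∧ (p.1 ≠ p.2 → ∀ ξ : sobolev k C,
      |(inner ℂ (T p.1 (deriv (s p.1) ξ)) (T p.2 (deriv (s p.2) ξ))).re| ≤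
        K * ((‖deriv (s p.1) ξ‖ + ‖deriv (s p.2) ξ‖) * ‖(ξ : L2 (Zk k) C)‖)) := by
    intro p
    by_cases hp : p.1 = p.2
    -- Diagonal pairs get the constant `0`: their terms are summed exactly and never estimated.
    · exact ⟨0, le_rfl, fun h => absurd hp h⟩
    · obtain ⟨K, hK0, hK⟩ := hT.abs_re_inner_le hp
      exact ⟨K, hK0, fun _ => hK⟩
  choose K hK0 hK using hK
  let L : ℝ := ∑ p, 2 * K p
  have hL : 0 ≤ L := Finset.sum_nonneg fun p _ => mul_nonneg zero_le_two (hK0 p)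
  refine ⟨L ^ 2, by positivity, fun ξ => ?_⟩
  set S : ℝ := √(∑ j, ‖deriv j ξ‖ ^ 2) with hS
  have hS0 : 0 ≤ S := Real.sqrt_nonneg _
  have hS2 : S ^ 2 = ∑ j, ‖deriv j ξ‖ ^ 2 := Real.sq_sqrt (by positivity)
  have hSj : ∀ j, ‖deriv j ξ‖ ≤ S := fun j => Real.le_sqrt_of_sq_le
    (Finset.single_le_sum (f := fun j => ‖deriv j ξ‖ ^ 2) (fun _ _ => by positivity)
      (Finset.mem_univ j))
  let q : I × I → ℝ := fun p =>
    (inner ℂ (T p.1 (deriv (s p.1) ξ)) (T p.2 (deriv (s p.2) ξ))).re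
  have hq : ∀ p, p.1 ≠ p.2 → |q p| ≤ 2 * K p * (S * ‖(ξ : L2 (Zk k) C)‖) := fun p hp =>
    (hK p hp ξ).trans (by
      have h1 : (‖deriv (s p.1) ξ‖ + ‖deriv (s p.2) ξ‖) * ‖(ξ : L2 (Zk k) C)‖ ≤
          2 * (S * ‖(ξ : L2 (Zk k) C)‖) := by
        rw [← mul_assoc, two_mul]
        exact mul_le_mul_of_nonneg_right (add_le_add (hSj _) (hSj _)) (norm_nonneg _)
      calc _ ≤ K p * (2 * (S * ‖(ξ : L2 (Zk k) C)‖)) := mul_le_mul_of_nonneg_left h1 (hK0 p)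
        _ = _ := by ring)
  have h1 : ‖principal s T ξ‖ ^ 2 = ∑ p, q p := by
    rw [← @inner_self_eq_norm_sq ℂ, principal_apply, sum_inner]
    simp only [inner_sum]
    rw [Fintype.sum_prod_type]
    simp [q]
  have h2 : S ^ 2 = ∑ p : I × I, if p.1 = p.2 then q p else 0 := by
    rw [hS2, ← hT.sum_norm_sq, Fintype.sum_prod_type]
    refine Finset.sum_congr rfl fun i _ => ?_
    rw [Finset.sum_ite_eq, if_pos (Finset.mem_univ i), ← @inner_self_eq_norm_sq ℂ]
    rfl
  have h3 : S ^ 2 - ‖principal s T ξ‖ ^ 2 ≤ L * (S * ‖(ξ : L2 (Zk k) C)‖) := by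
    rw [h1, h2, ← Finset.sum_sub_distrib, Finset.sum_mul]
    refine Finset.sum_le_sum fun p _ => ?_
    split_ifs with hp
    · rw [sub_self]
      exact mul_nonneg (mul_nonneg zero_le_two (hK0 p)) (mul_nonneg hS0 (norm_nonneg _))
    · rw [zero_sub]
      exact (neg_le_abs _).trans (hq p hp)
  rw [← hS2]
  -- So far `S² ≤ ‖P ξ‖² + L S ‖ξ‖`. Bounding the last product by `(S² + L² ‖ξ‖²) / 2` and absorbing
  -- `S² / 2` gives the factor `2` and the constant `L²`.
  nlinarith [sq_nonneg (S - L * ‖(ξ : L2 (Zk k) C)‖)]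

variable (B : L2 (Zk k) C →L[ℂ] L2 (Zk k) C)

theorem exists_sum_norm_sq_le_add : ∃ K : ℝ, 0 ≤ K ∧ ∀ ξ : sobolev k C,
    ∑ j, ‖deriv j ξ‖ ^ 2 ≤ 4 * ‖B ξ + principal s T ξ‖ ^ 2 + K * ‖(ξ : L2 (Zk k) C)‖ ^ 2 := by
  obtain ⟨K, hK0, hK⟩ := hT.exists_sum_norm_sq_le
  -- From `(a + b)² ≤ 2 a² + 2 b²` applied to `P ξ = (B ξ + P ξ) - B ξ`, after the factor `2` of the
  -- elliptic estimate.
  refine ⟨K + 4 * ‖B‖ ^ 2, by positivity, fun ξ => (hK ξ).trans ?_⟩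
  have h1 : ‖principal s T ξ‖ ≤ ‖B ξ + principal s T ξ‖ + ‖B‖ * ‖(ξ : L2 (Zk k) C)‖ := by
    calc ‖principal s T ξ‖ = ‖(B ξ + principal s T ξ) - B ξ‖ := by rw [add_sub_cancel_left]
      _ ≤ _ := (norm_sub_le _ _).trans (add_le_add_right (B.le_opNorm _) _)
  have h2 : ‖principal s T ξ‖ ^ 2 ≤ (‖B ξ + principal s T ξ‖ + ‖B‖ * ‖(ξ : L2 (Zk k) C)‖) ^ 2 := by
    gcongr
  nlinarith [sq_nonneg (‖B ξ + principal s T ξ‖ - ‖B‖ * ‖(ξ : L2 (Zk k) C)‖)]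

theorem exists_norm_regularize_commutator_le : ∃ K : ℝ, 0 ≤ K ∧ ∀ (ε : ℝ) (hε : 0 < ε)
    (ξ : sobolev k C),
    ‖decayOp k C hε (B ξ + principal s T ξ) -
      (B (decayOp k C hε ξ) + principal s T (regularize hε (ξ : L2 (Zk k) C)))‖ ≤
        K * ‖(ξ : L2 (Zk k) C)‖ := by
  choose K hK0 hK using hT.regular
  refine ⟨2 * ‖B‖ + ∑ i, K i,
    add_nonneg (by positivity) (Finset.sum_nonneg fun i _ => hK0 i), fun ε hε ξ => ?_⟩
  -- For the bounded part no cancellation is needed, as the regularizers are contractions;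
  -- regularity matters only for the first order part.
  have h1 : ‖decayOp k C hε (B ξ) - B (decayOp k C hε ξ)‖ ≤ 2 * ‖B‖ * ‖(ξ : L2 (Zk k) C)‖ := by
    have h2 := (norm_decayOp_apply_le hε (B ξ)).trans (B.le_opNorm ξ)
    have h3 := (B.le_opNorm (decayOp k C hε ξ)).trans
      (mul_le_mul_of_nonneg_left (norm_decayOp_apply_le hε (ξ : L2 (Zk k) C)) (norm_nonneg B))
    linarith [norm_sub_le (decayOp k C hε (B ξ)) (B (decayOp k C hε ξ))]
  rw [map_add, add_sub_add_comm, add_mul]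
  refine (norm_add_le _ _).trans (add_le_add h1 ?_)
  rw [principal_apply, principal_apply, map_sum, ← Finset.sum_sub_distrib, Finset.sum_mul]
  refine (norm_sum_le _ _).trans (Finset.sum_le_sum fun i _ => ?_)
  rw [deriv_regularize]
  exact hK i ε hε _ ξ

variable {B}

/-- The regularized vectors have bounded images under `D`, uniformly in `ε`, so the elliptic
estimate bounds their derivatives uniformly; hence every vector of the adjoint domain is already in
the Sobolev space. -/
theorem isSelfAdjoint (hB : IsSelfAdjoint B) {D : L2 (Zk k) C →ₗ.[ℂ] L2 (Zk k) C}
    (hdom : D.domain = sobolev k C)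
    (hD : ∀ (ξ : D.domain) (η : sobolev k C), (ξ : L2 (Zk k) C) = η →
      D ξ = B η + principal s T η) : IsSelfAdjoint D := by
  obtain ⟨dom, toFun⟩ := D
  obtain rfl : dom = sobolev k C := hdom
  replace hD : ∀ ξ : sobolev k C, toFun ξ = B ξ + principal s T ξ := fun ξ => hD ξ ξ rfl
  have hsymm : ∀ x y : sobolev k C,
      inner ℂ (toFun x) (y : L2 (Zk k) C) = inner ℂ (x : L2 (Zk k) C) (toFun y) := fun x y => by
    rw [hD, hD, inner_add_left, inner_add_right, hT.inner_principal,
      ← ContinuousLinearMap.adjoint_inner_right, ← ContinuousLinearMap.star_eq_adjoint, hB.star_eq]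
  obtain ⟨K, hK0, hK⟩ := hT.exists_norm_regularize_commutator_le B
  obtain ⟨L, hL0, hL⟩ := hT.exists_sum_norm_sq_le_add B
  refine isSelfAdjoint_of_adjoint_domain_le dense_sobolev hsymm fun ξ hξ => ?_
  set D : L2 (Zk k) C →ₗ.[ℂ] L2 (Zk k) C := ⟨sobolev k C, toFun⟩ with hDdef
  refine mem_sobolev_of_decayOp_le
    (K := 4 * (‖D.adjoint ⟨ξ, hξ⟩‖ + K * ‖ξ‖) ^ 2 + L * ‖ξ‖ ^ 2) fun ε hε => ?_
  have h1 := norm_apply_regularization_le (D := D) dense_sobolev hsymm (decayOp k C hε)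
    (inner_decayOp_left hε) (norm_decayOp_apply_le hε) (decayOp_mem_sobolev hε) hK0
    (fun η => by
      have := hK ε hε η
      have h := hD (regularize hε (η : L2 (Zk k) C))
      rw [coe_regularize] at h
      rw [← hD η, ← h] at this
      exact this) ⟨ξ, hξ⟩
  have h2 := hL (regularize hε ξ)
  rw [← hD] at h2
  refine h2.trans (add_le_add ?_ ?_)
  · gcongr
    exact h1
  · gcongr
    exact norm_decayOp_apply_le hε ξ

end IsDiracSymbol

/-! ### Compactness of the resolvent -/

/-- Restriction to a finite set of indices. -/
def truncate {ι : Type*} [DecidableEq ι] (E : Type*) [NormedAddCommGroup E] [NormedSpace ℂ E]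
    (S : Finset ι) : L2 ι E →L[ℂ] L2 ι E :=
  mulOp E (fun i => if i ∈ S then 1 else 0) 1 zero_le_one fun i => by split_ifs <;> simp

/-- Each coordinate evaluation factors through the finite dimensional `E`. -/
theorem isCompactOperator_truncate {ι : Type*} [DecidableEq ι] (E : Type*) [NormedAddCommGroup E]
    [NormedSpace ℂ E] [FiniteDimensional ℂ E] (S : Finset ι) :
    IsCompactOperator (truncate E S) := by
  have : ProperSpace E := FiniteDimensional.proper ℂ E
  have h : truncate E S = ∑ i ∈ S, (lp.singleContinuousLinearMap ℂ (fun _ : ι => E) 2 i).comp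
      (lp.evalCLM ℂ (fun _ : ι => E) 2 i) := by
    ext ξ m
    rw [sum_apply, L2_sum_apply]
    simp [truncate, lp.single_apply, Pi.single_apply, ite_smul]
    rfl
  rw [h]
  refine (compactOperator (RingHom.id ℂ) (L2 ι E) (L2 ι E)).sum_mem fun i _ => ?_
  exact (isCompactOperator_of_locallyCompactSpace_dom
    (lp.evalCLM ℂ (fun _ : ι => E) 2 i)).clm_comp
      (lp.singleContinuousLinearMap ℂ (fun _ : ι => E) 2 i)

/-- Infinite coordinates are integers bounded by the weight and finite ones range over a finite
group. The value `k j = 0` is excluded because it would also give `ZMod 0 = ℤ`, with no control from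
the weight. -/
theorem finite_setOf_weight_le (hk : ∀ j, k j ≠ 0) (r : ℝ) : {m : Zk k | weight m ≤ r}.Finite := by
  refine (Set.Finite.pi' (t := fun j => {x : ZMod (k j).toNat |
    k j = ⊤ → |((x.cast : ℤ) : ℝ)| ≤ r}) fun j => ?_).subset fun m hm j hj => ?_
  · by_cases hj : k j = ⊤
    · have h : ∀ n : ℕ, n = 0 → {x : ZMod n | |((x.cast : ℤ) : ℝ)| ≤ r}.Finite := by
        rintro _ rfl
        refine (Set.finite_Icc (-⌈r⌉) ⌈r⌉).subset fun x hx => ?_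
        have h1 : |((x : ℤ) : ℝ)| ≤ ⌈r⌉ := le_trans hx (Int.le_ceil r)
        rw [← Int.cast_abs, Int.cast_le] at h1
        exact abs_le.1 h1
      exact (h _ (by simp [hj])).subset fun x hx => hx hj
    · have : NeZero (k j).toNat := ⟨by simp [ENat.toNat_eq_zero, hj, hk j]⟩
      exact Set.toFinite _
  · refine le_trans (le_of_eq ?_) ((abs_infCoord_le_weight m j).trans hm)
    rw [infCoord, if_pos hj, intCoord]

/-- A Rellich argument: outside `{w ≤ r + 1}` the weighted bound makes the tail of `R x` at most `M
‖x‖ / (r + 1)`, so `R` is a norm limit of its truncations. -/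
theorem isCompactOperator_of_weight_bound (hk : ∀ j, k j ≠ 0) {H : Type*} [NormedAddCommGroup H]
    [NormedSpace ℂ H] (R : H →L[ℂ] L2 (Zk k) C) {K : ℝ} (hR : ∀ x, ∃ h : R x ∈ sobolev k C,
      ∑ j, ‖deriv j ⟨R x, h⟩‖ ^ 2 ≤ K * ‖x‖ ^ 2) : IsCompactOperator R := by
  classical
  let M : ℝ := √(‖R‖ ^ 2 + |K|)
  have hM : M ^ 2 = ‖R‖ ^ 2 + |K| := Real.sq_sqrt (by positivity)
  let S : ℕ → Finset (Zk k) := fun r => (finite_setOf_weight_le hk (r + 1)).toFinset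
  have hlim : Tendsto (fun r => (truncate C (S r)).comp R) atTop (𝓝 R) → IsCompactOperator R :=
    fun h => isCompactOperator_of_tendsto h
      (Eventually.of_forall fun r => (isCompactOperator_truncate C (S r)).comp_clm R)
  refine hlim ((tendsto_iff_norm_sub_tendsto_zero (E := H →L[ℂ] L2 (Zk k) C)).2 ?_)
  refine squeeze_zero (g := fun r : ℕ => M * (1 / ((r : ℝ) + 1)))
    (fun r => norm_nonneg ((truncate C (S r)).comp R - R))
    (fun r => ?_) (by simpa using tendsto_one_div_add_atTop_nhds_zero_nat.const_mul M)
  refine ContinuousLinearMap.opNorm_le_bound _ (by positivity) fun x => ?_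
  obtain ⟨hx, hxK⟩ := hR x
  have h1 := tsum_weight_sq_mul ⟨R x, hx⟩
  have h2 : ‖R x‖ ^ 2 ≤ ‖R‖ ^ 2 * ‖x‖ ^ 2 := by
    rw [← mul_pow]
    gcongr
    exact R.le_opNorm x
  have h3 : K * ‖x‖ ^ 2 ≤ |K| * ‖x‖ ^ 2 := by gcongr; exact le_abs_self K
  have h4 : ∑' m, weight m ^ 2 * ‖R x m‖ ^ 2 ≤ (M * ‖x‖) ^ 2 := by
    rw [mul_pow, hM, add_mul]
    linarith
  have hr : (0 : ℝ) < r + 1 := by positivity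
  refine le_of_sq_le_sq ?_ (by positivity)
  rw [show M * (1 / ((r : ℝ) + 1)) * ‖x‖ = (M * ‖x‖) / (r + 1) by ring, div_pow,
    le_div_iff₀ (by positivity), mul_comm, norm_sq_eq, ← tsum_mul_left]
  refine le_trans (Summable.tsum_le_tsum (fun m => ?_) ((summable_norm_sq _).mul_left _)
    (mem_sobolev_iff.1 hx)) h4
  have h5 : (((truncate C (S r)).comp R - R) x) m =
      (if m ∈ S r then (1 : ℂ) else 0) • R x m - R x m := rfl
  rw [h5]
  split_ifs with hm
  · rw [one_smul, sub_self, norm_zero, zero_pow two_ne_zero, mul_zero]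
    have := weight_pos m
    positivity
  · rw [zero_smul, zero_sub, norm_neg]
    have : (r : ℝ) + 1 ≤ weight m := by
      by_contra hcon
      exact hm ((Set.Finite.mem_toFinset _).2 (not_le.1 hcon).le)
    gcongr

/-- Since `D R x = x + z R x`, the graph norm of `R x` is controlled by `‖x‖`, and the elliptic
bound turns this into control of the derivatives. -/
theorem hasCompactResolvent_of_bound (hk : ∀ j, k j ≠ 0) {D : L2 (Zk k) C →ₗ.[ℂ] L2 (Zk k) C}
    (hD : IsSelfAdjoint D) (hdom : D.domain = sobolev k C) {L : ℝ}
    (hL : ∀ (ξ : D.domain) (η : sobolev k C), (ξ : L2 (Zk k) C) = η →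
      ∑ j, ‖deriv j η‖ ^ 2 ≤ 4 * ‖D ξ‖ ^ 2 + L * ‖(ξ : L2 (Zk k) C)‖ ^ 2) :
    HasCompactResolvent D := by
  refine ⟨⟨_, exists_isResolventAt_I hD⟩, fun z R hR => ?_⟩
  refine isCompactOperator_of_weight_bound hk R (K := 4 * (1 + ‖z‖ * ‖R‖) ^ 2 + |L| * ‖R‖ ^ 2)
    fun x => ?_
  obtain ⟨h, hx⟩ := hR.1 x
  refine ⟨hdom ▸ h, (hL ⟨R x, h⟩ _ rfl).trans ?_⟩
  have h1 : ‖D ⟨R x, h⟩‖ ≤ (1 + ‖z‖ * ‖R‖) * ‖x‖ := by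
    rw [sub_eq_iff_eq_add.1 hx, add_mul, one_mul, mul_assoc]
    refine (norm_add_le _ _).trans (add_le_add le_rfl ?_)
    rw [norm_smul]
    exact mul_le_mul_of_nonneg_left (R.le_opNorm x) (norm_nonneg z)
  have h2 : ‖D ⟨R x, h⟩‖ ^ 2 ≤ ((1 + ‖z‖ * ‖R‖) * ‖x‖) ^ 2 := by gcongr
  have h3 : ‖R x‖ ^ 2 ≤ (‖R‖ * ‖x‖) ^ 2 := by gcongr; exact R.le_opNorm x
  have h4 : L * ‖R x‖ ^ 2 ≤ |L| * (‖R‖ * ‖x‖) ^ 2 :=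
    (mul_le_mul_of_nonneg_right (le_abs_self L) (by positivity)).trans
      (mul_le_mul_of_nonneg_left h3 (abs_nonneg L))
  change 4 * ‖D ⟨R x, h⟩‖ ^ 2 + L * ‖R x‖ ^ 2 ≤ _
  rw [mul_pow] at h2 h4
  linarith

end DiracType

/-! ### The twisted convolution algebra -/

namespace NormalizedCocycle

variable {G : Type*} [AddCommGroup G] (σ : NormalizedCocycle G)

theorem mul_neg_left (x y : G) : σ (-x) (x + y) * σ x y = 1 := by
  have h := σ.cocycle (-x) x y
  have h1 := σ.normalized (-x)
  rw [neg_neg] at h1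
  rw [neg_add_cancel, σ.zero_left, h1, one_mul] at h
  exact h.symm

/-- The cocycle is invariant under cyclic rotation of triples with sum zero, by the cocycle identity
and `σ(x, -x) = 1`. -/
theorem rotate (x y : G) : σ y (-x - y) = σ x y := by
  have h := σ.cocycle x y (-x - y)
  rw [show -x - y = -(x + y) by abel, σ.normalized, show y + -(x + y) = -x by abel, σ.normalized,
    mul_one, one_mul] at h
  rw [h, show -x - y = -(x + y) by abel]

/-- The value at `(-x, -y)` is inverse to `σ(x, -x - y)`, which rotates to `σ(y, x)`. This exchange
of arguments is what turns `J a* J` into a right multiplication. -/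
theorem conj_neg_neg (x y : G) : conj (σ (-x) (-y) : ℂ) = σ y x := by
  have h1 := σ.mul_neg_left x (-x - y)
  have h2 := σ.rotate x y
  have h3 := σ.rotate y (-x - y)
  rw [show x + (-x - y) = -y by abel] at h1
  rw [show -y - (-x - y) = x by abel] at h3
  have h4 : σ x (-x - y) = σ y x := by
    have := σ.rotate y x
    rwa [show -y - x = -x - y by abel] at this
  rw [h4] at h1
  rw [← Circle.coe_inv_eq_conj, inv_eq_of_mul_eq_one_right h1]

end NormalizedCocycle

section Convolution

variable {N : ℕ} {k : Fin N → ℕ∞} (σ : NormalizedCocycle (Zk k))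

theorem W_apply (m : Zk k) (ξ : L2 (Zk k) ℂ) (n : Zk k) :
    W σ m ξ n = σ m (n - m) * ξ (n - m) := rfl

theorem W_zero : W σ 0 = 1 := by
  ext ξ n
  rw [W_apply, σ.zero_left]
  simp

theorem W_mul (m n : Zk k) : W σ m * W σ n = (σ m n : ℂ) • W σ (m + n) := by
  ext ξ p
  have h := σ.cocycle m n (p - m - n)
  rw [show n + (p - m - n) = p - m by abel] at h
  rw [mul_apply_eq_comp, W_apply, W_apply, smul_apply, lp.coeFn_smul, Pi.smul_apply, W_apply,
    smul_eq_mul, ← mul_assoc, ← mul_assoc, ← sub_sub, ← Circle.coe_mul, ← Circle.coe_mul, h]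

theorem star_W (m : Zk k) : star (W σ m) = W σ (-m) := by
  symm
  rw [ContinuousLinearMap.star_eq_adjoint, ContinuousLinearMap.eq_adjoint_iff]
  intro x y
  rw [lp.inner_eq_tsum, lp.inner_eq_tsum, ← (Equiv.subRight m).tsum_eq]
  refine tsum_congr fun n => ?_
  have h := σ.mul_neg_left m (n - m)
  rw [add_sub_cancel] at h
  have h1 : conj (σ (-m) n : ℂ) = σ m (n - m) := by
    rw [← Circle.coe_inv_eq_conj, inv_eq_of_mul_eq_one_right h]
  simp only [Equiv.subRight_apply, W_apply, sub_neg_eq_add, sub_add_cancel, RCLike.inner_apply,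
    map_mul, h1]
  ring

theorem star_W_mul_W (m : Zk k) : star (W σ m) * W σ m = 1 := by
  rw [star_W, W_mul, neg_add_cancel, W_zero]
  have := σ.normalized (-m)
  rw [neg_neg] at this
  simp [this]

theorem W_mul_star_W (m : Zk k) : W σ m * star (W σ m) = 1 := by
  rw [star_W, W_mul, add_neg_cancel, W_zero, σ.normalized]
  simp

theorem coe_rep (g : Zk k →₀ ℂ) : (rep σ g).1 = g.sum fun m z => z • W σ m := by
  rw [rep, Finsupp.sum, Finsupp.sum, AddSubmonoidClass.coe_finsetSum]
  rfl

/-- The function `m ↦ g m` is recovered from `π(g)`. -/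
theorem rep_single_zero_apply [DecidableEq (Zk k)] (g : Zk k →₀ ℂ) (n : Zk k) :
    (rep σ g).1 (lp.single 2 0 1) n = g n := by
  rw [coe_rep, Finsupp.sum, sum_apply, L2_sum_apply, Finset.sum_eq_single n]
  · rw [smul_apply, lp.coeFn_smul, Pi.smul_apply, W_apply, sub_self, σ.zero_right,
      lp.single_apply_self]
    simp
  · intro m _ hm
    rw [smul_apply, lp.coeFn_smul, Pi.smul_apply, W_apply,
      lp.single_apply_ne _ _ _ (sub_ne_zero.2 hm.symm)]
    simp
  · intro h
    rw [Finsupp.notMem_support_iff.1 h]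
    simp

theorem mem_span_W_mul {a b : L2 (Zk k) ℂ →L[ℂ] L2 (Zk k) ℂ}
    (ha : a ∈ Submodule.span ℂ (Set.range (W σ))) (hb : b ∈ Submodule.span ℂ (Set.range (W σ))) :
    a * b ∈ Submodule.span ℂ (Set.range (W σ)) := by
  have h := Submodule.mul_mem_mul ha hb
  rw [Submodule.span_mul_span] at h
  refine Submodule.span_le.2 ?_ h
  rintro _ ⟨_, ⟨m, rfl⟩, _, ⟨n, rfl⟩, rfl⟩
  change W σ m * W σ n ∈ _
  rw [W_mul]
  exact Submodule.smul_mem _ _ (Submodule.subset_span ⟨_, rfl⟩)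

theorem mem_span_W_star {a : L2 (Zk k) ℂ →L[ℂ] L2 (Zk k) ℂ}
    (ha : a ∈ Submodule.span ℂ (Set.range (W σ))) :
    star a ∈ Submodule.span ℂ (Set.range (W σ)) := by
  induction ha using Submodule.span_induction with
  | mem x hx =>
    obtain ⟨m, rfl⟩ := hx
    rw [star_W]
    exact Submodule.subset_span ⟨_, rfl⟩
  | zero => rw [star_zero]; exact zero_mem _
  | add x y _ _ hx hy => rw [star_add]; exact add_mem hx hy
  | smul z x _ hx => rw [star_smul]; exact Submodule.smul_mem _ _ hx

theorem mem_span_W_of_mem_adjoin {a : L2 (Zk k) ℂ →L[ℂ] L2 (Zk k) ℂ}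
    {s : Set (L2 (Zk k) ℂ →L[ℂ] L2 (Zk k) ℂ)} (hs : s ⊆ Set.range (W σ))
    (ha : a ∈ StarAlgebra.adjoin ℂ s) : a ∈ Submodule.span ℂ (Set.range (W σ)) := by
  induction ha using StarAlgebra.adjoin_induction with
  | mem x hx => exact Submodule.subset_span (hs hx)
  | algebraMap r =>
    rw [Algebra.algebraMap_eq_smul_one, ← W_zero σ]
    exact Submodule.smul_mem _ _ (Submodule.subset_span ⟨_, rfl⟩)
  | add x y _ _ hx hy => exact add_mem hx hy
  | mul x y _ _ hx hy => exact mem_span_W_mul σ hx hy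
  | star x _ hx => exact mem_span_W_star σ hx

theorem exists_eq_rep {a : L2 (Zk k) ℂ →L[ℂ] L2 (Zk k) ℂ}
    (ha : a ∈ Submodule.span ℂ (Set.range (W σ))) : ∃ g, a = (rep σ g).1 := by
  rw [Finsupp.mem_span_range_iff_exists_finsupp] at ha
  obtain ⟨g, rfl⟩ := ha
  exact ⟨g, (coe_rep σ g).symm⟩

end Convolution

/-! ### The right action -/

section RightAction

variable {N : ℕ} {k : Fin N → ℕ∞} (σ : NormalizedCocycle (Zk k))

@[simp]
theorem J_apply (ξ : L2 (Zk k) ℂ) (n : Zk k) : J k ξ n = conj (ξ (-n)) := rfl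

theorem inner_J_left (ξ η : L2 (Zk k) ℂ) : inner ℂ (J k ξ) η = inner ℂ (J k η) ξ := by
  rw [lp.inner_eq_tsum, lp.inner_eq_tsum, ← (Equiv.neg (Zk k)).tsum_eq]
  refine tsum_congr fun n => ?_
  simp [mul_comm]

theorem rightAct_apply (a : L2 (Zk k) ℂ →L[ℂ] L2 (Zk k) ℂ) (ξ : L2 (Zk k) ℂ) :
    rightAct a ξ = J k (star a (J k ξ)) := rfl

theorem rightAct_add (a b : L2 (Zk k) ℂ →L[ℂ] L2 (Zk k) ℂ) :
    rightAct (a + b) = rightAct a + rightAct b := by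
  ext1 ξ
  simp [rightAct_apply]

theorem rightAct_smul (z : ℂ) (a : L2 (Zk k) ℂ →L[ℂ] L2 (Zk k) ℂ) :
    rightAct (z • a) = z • rightAct a := by
  ext1 ξ
  simp [rightAct_apply]

theorem star_rightAct (a : L2 (Zk k) ℂ →L[ℂ] L2 (Zk k) ℂ) :
    star (rightAct a) = rightAct (star a) := by
  symm
  rw [ContinuousLinearMap.star_eq_adjoint (rightAct a), ContinuousLinearMap.eq_adjoint_iff]
  intro x y
  rw [rightAct_apply, rightAct_apply, star_star, inner_J_left (a (J k x)) y, ← inner_conj_symm x,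
    inner_J_left (star a (J k y)) x, inner_conj_symm, ContinuousLinearMap.star_eq_adjoint,
    ContinuousLinearMap.adjoint_inner_left]

theorem rightAct_W_apply (m : Zk k) (ξ : L2 (Zk k) ℂ) (n : Zk k) :
    rightAct (W σ m) ξ n = σ (n - m) m * ξ (n - m) := by
  rw [rightAct_apply, star_W, J_apply, W_apply, J_apply, map_mul, Complex.conj_conj,
    show -n - -m = -(n - m) by abel, σ.conj_neg_neg, neg_neg]

/-- Left and right twisted translations commute exactly by the cocycle identity, that is, by
associativity of twisted convolution. -/
theorem commute_rightAct_W (m p : Zk k) : Commute (rightAct (W σ m)) (W σ p) := by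
  ext ξ n
  have h := σ.cocycle p (n - m - p) m
  rw [show p + (n - m - p) = n - m by abel, show n - m - p + m = n - p by abel] at h
  rw [mul_apply_eq_comp, mul_apply_eq_comp, rightAct_W_apply, W_apply, W_apply, rightAct_W_apply,
    ← mul_assoc, ← mul_assoc, ← Circle.coe_mul, ← Circle.coe_mul, mul_comm (σ _ _),
    show n - p - m = n - m - p by abel, h]

theorem commute_rightAct_of_mem_span {a b : L2 (Zk k) ℂ →L[ℂ] L2 (Zk k) ℂ}
    (ha : a ∈ Submodule.span ℂ (Set.range (W σ))) (hb : b ∈ Submodule.span ℂ (Set.range (W σ))) :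
    Commute (rightAct a) b := by
  induction ha using Submodule.span_induction with
  | mem x hx =>
    obtain ⟨m, rfl⟩ := hx
    induction hb using Submodule.span_induction with
    | mem y hy =>
      obtain ⟨p, rfl⟩ := hy
      exact commute_rightAct_W σ m p
    | zero => exact Commute.zero_right _
    | add x y _ _ hx hy => exact hx.add_right hy
    | smul z x _ hx => exact hx.smul_right z
  | zero =>
    have h := rightAct_smul (0 : ℂ) (0 : L2 (Zk k) ℂ →L[ℂ] L2 (Zk k) ℂ)
    rw [zero_smul, zero_smul] at h
    rw [h]
    exact Commute.zero_left _
  | add x y _ _ hx hy => rw [rightAct_add]; exact hx.add_left hy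
  | smul z x _ hx => rw [rightAct_smul]; exact hx.smul_left z

end RightAction

/-! ### Real and imaginary parts -/

section Parts

variable {A : Type*} [Ring A] [StarRing A] [Algebra ℂ A]

theorem star_rePart [StarModule ℂ A] (a : A) : star (rePart a) = rePart a := by
  simp [rePart, add_comm]

theorem star_imPart [StarModule ℂ A] (a : A) : star (imPart a) = imPart a := by
  have h : star (1 / (2 * Complex.I) : ℂ) = -(1 / (2 * Complex.I)) := by
    simp
  rw [imPart, star_smul, h, star_sub, star_star, neg_smul, ← smul_neg, neg_sub]

/-- The identity `cos² + sin² = 1` for a unitary, from `(a + a*)² - (a - a*)² = 2 a* a + 2 a a*`. -/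
theorem rePart_mul_self_add_imPart_mul_self {a : A} (h1 : star a * a = 1) (h2 : a * star a = 1) :
    rePart a * rePart a + imPart a * imPart a = 1 := by
  have h : (1 / (2 * Complex.I) : ℂ) * (1 / (2 * Complex.I)) = -(1 / 2 * (1 / 2)) := by
    field_simp
    simp
  rw [rePart, imPart, smul_mul_smul_comm, smul_mul_smul_comm, h, neg_smul, ← sub_eq_add_neg,
    ← smul_sub]
  have : (a + star a) * (a + star a) - (a - star a) * (a - star a) = (4 : ℂ) • (1 : A) := by
    rw [show (a + star a) * (a + star a) - (a - star a) * (a - star a) =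
      2 • (star a * a) + 2 • (a * star a) by noncomm_ring, h1, h2, ← add_nsmul,
      ← Nat.cast_smul_eq_nsmul ℂ]
    norm_num
  rw [this, smul_smul]
  norm_num

theorem commute_rePart {a b : A} (h1 : Commute b a) (h2 : Commute b (star a)) :
    Commute b (rePart a) := (h1.add_right h2).smul_right _

theorem commute_imPart {a b : A} (h1 : Commute b a) (h2 : Commute b (star a)) :
    Commute b (imPart a) := (h1.sub_right h2).smul_right _

theorem commute_star_of_mul_eq_one {A : Type*} [Ring A] [StarRing A] {a b : A}
    (h1 : star a * a = 1) (h2 : a * star a = 1) (h : Commute b a) : Commute b (star a) := by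
  calc b * star a = star a * a * (b * star a) := by rw [h1, one_mul]
    _ = star a * (a * b) * star a := by noncomm_ring
    _ = star a * (b * a) * star a := by rw [h.eq]
    _ = star a * b * (a * star a) := by noncomm_ring
    _ = star a * b := by rw [h2, mul_one]

end Parts

/-! ### The coefficients of the Dirac operator -/

section Coefficients

variable {N : ℕ} {k : Fin N → ℕ∞} (σ : NormalizedCocycle (Zk k)) (f : Equiv.Perm (Fin N))

theorem coe_U (j : Fin N) : (U σ j).1 = W σ (Pi.single j 1) := rfl

theorem coe_X (j : Fin N) : (X σ f j).1 = rePart (W σ (Pi.single (f j) 1)) := rfl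

theorem coe_Y (j : Fin N) : (Y σ f j).1 = fsgn f j • imPart (W σ (Pi.single (f j) 1)) := rfl

theorem star_fsgn (j : Fin N) : star (fsgn f j) = fsgn f j := by
  unfold fsgn
  split_ifs <;> simp

theorem fsgn_mul_self (j : Fin N) : fsgn f j * fsgn f j = 1 := by
  unfold fsgn
  split_ifs <;> simp

theorem star_X (j : Fin N) : star (X σ f j).1 = (X σ f j).1 := star_rePart _

theorem star_Y (j : Fin N) : star (Y σ f j).1 = (Y σ f j).1 := by
  rw [coe_Y, star_smul, star_imPart, star_fsgn]

theorem X_mul_self_add_Y_mul_self (j : Fin N) :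
    (X σ f j).1 * (X σ f j).1 + (Y σ f j).1 * (Y σ f j).1 = 1 := by
  rw [coe_X, coe_Y, smul_mul_smul_comm, fsgn_mul_self, one_smul,
    rePart_mul_self_add_imPart_mul_self (star_W_mul_W σ _) (W_mul_star_W σ _)]

/-- The set `P` records which translations occur. It will be the set of `m` with a vanishing
coordinate, so that the derivative in that direction commutes with the coefficient. -/
theorem X_mem_span {P : Set (Zk k)} {j : Fin N} (h : Pi.single (f j) 1 ∈ P)
    (h' : -Pi.single (f j) 1 ∈ P) : (X σ f j).1 ∈ Submodule.span ℂ (W σ '' P) := by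
  rw [coe_X, rePart, star_W]
  exact Submodule.smul_mem _ _ (add_mem (Submodule.subset_span ⟨_, h, rfl⟩)
    (Submodule.subset_span ⟨_, h', rfl⟩))

theorem Y_mem_span {P : Set (Zk k)} {j : Fin N} (h : Pi.single (f j) 1 ∈ P)
    (h' : -Pi.single (f j) 1 ∈ P) : (Y σ f j).1 ∈ Submodule.span ℂ (W σ '' P) := by
  rw [coe_Y, imPart, star_W]
  exact Submodule.smul_mem _ _ (Submodule.smul_mem _ _ (sub_mem (Submodule.subset_span ⟨_, h, rfl⟩)
    (Submodule.subset_span ⟨_, h', rfl⟩)))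

theorem commute_X {b : L2 (Zk k) ℂ →L[ℂ] L2 (Zk k) ℂ} {j : Fin N}
    (h : Commute b (U σ (f j)).1) : Commute b (X σ f j).1 :=
  commute_rePart h (commute_star_of_mul_eq_one (star_W_mul_W σ _) (W_mul_star_W σ _) h)

theorem commute_Y {b : L2 (Zk k) ℂ →L[ℂ] L2 (Zk k) ℂ} {j : Fin N}
    (h : Commute b (U σ (f j)).1) : Commute b (Y σ f j).1 :=
  (commute_imPart h
    (commute_star_of_mul_eq_one (star_W_mul_W σ _) (W_mul_star_W σ _) h)).smul_right _

/-- An operator which commutes with the generators of the subtorus, and with their adjoints,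
commutes with the subtorus. -/
theorem commute_of_mem_subtorus {d : ℕ} {a b : L2 (Zk k) ℂ →L[ℂ] L2 (Zk k) ℂ}
    (hb : ∀ s : Fin N, (s : ℕ) < d → Commute b (U σ s).1) (ha : a ∈ subtorus d σ) :
    Commute b a := by
  -- The closed algebra lies in the bicommutant of its generators, which makes a separate limiting
  -- argument unnecessary.
  have h := StarSubalgebra.topologicalClosure_adjoin_le_centralizer_centralizer ℂ _ ha
  rw [StarSubalgebra.mem_centralizer_iff] at h
  refine (h b ?_).1
  rw [SetLike.mem_coe, StarSubalgebra.mem_centralizer_iff]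
  rintro _ ⟨s, hs, rfl⟩
  exact ⟨(hb s hs).symm, (commute_star_of_mul_eq_one (star_W_mul_W σ _) (W_mul_star_W σ _)
    (hb s hs)).symm⟩

/-- Multiplication by a function of the `j`-th coordinate commutes with `U_s`, for `s ≠ j`. -/
theorem commute_U_of_forall_apply {b : L2 (Zk k) ℂ →L[ℂ] L2 (Zk k) ℂ} {j s : Fin N} (hs : s ≠ j)
    {φ : ZMod (k j).toNat → ℂ} (hb : ∀ ξ n, b ξ n = φ (n j) * ξ n) : Commute b (U σ s).1 := by
  ext ξ n
  rw [coe_U, mul_apply_eq_comp, mul_apply_eq_comp, hb, W_apply, W_apply, hb, Pi.sub_apply,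
    Pi.single_eq_of_ne hs.symm, sub_zero]
  ring

theorem dualUnitary_zElt_apply {j : Fin N} (hj : k j ≠ ⊤) (ξ : L2 (Zk k) ℂ) (n : Zk k) :
    dualUnitary k (zElt k j) ξ n =
      (Circle.exp (2 * Real.pi / (k j).toNat) ^ ((n j).cast : ℤ) : Circle) * ξ n := by
  change ((∏ i, zElt k j i ^ intCoord n i : Circle) : ℂ) * ξ n = _
  rw [Finset.prod_eq_single j]
  · simp [zElt, hj, intCoord]
  · intro i _ hi
    simp [zElt, hj, hi]
  · simp

theorem commute_imPart_dualUnitary {j s : Fin N} (hj : k j ≠ ⊤) (hs : s ≠ j) :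
    Commute (imPart (dualUnitary k (zElt k j))) (U σ s).1 := by
  have h : Commute (dualUnitary k (zElt k j)) (U σ s).1 := commute_U_of_forall_apply σ hs
    (φ := fun x => (Circle.exp (2 * Real.pi / (k j).toNat) ^ (x.cast : ℤ) : Circle))
    (dualUnitary_zElt_apply hj)
  have h' := (commute_star_of_mul_eq_one (star_W_mul_W σ _) (W_mul_star_W σ _) h).star_star
  rw [star_star] at h'
  exact (commute_imPart h.symm h'.symm).symm

/-- The projection onto `{n | n j = 0}` commutes with `U_s` for `s ≠ j`, hence with the whole
subtorus, and it fixes the basis vector at `0`. So it fixes the image of that vector under `π(g)`,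
whose coordinates are the values of `g`. -/
theorem coord_eq_zero_of_rep_mem_subtorus {d : ℕ} {g : Zk k →₀ ℂ}
    (hg : (rep σ g).1 ∈ subtorus d σ) {j : Fin N} (hj : d ≤ (j : ℕ)) {m : Zk k} (hm : g m ≠ 0) :
    m j = 0 := by
  classical
  let b : L2 (Zk k) ℂ →L[ℂ] L2 (Zk k) ℂ := mulOp ℂ (fun n : Zk k => if n j = 0 then 1 else 0) 1
    zero_le_one fun n => by split_ifs <;> simp
  have hb : ∀ ξ n, b ξ n = (fun x : ZMod (k j).toNat => if x = 0 then (1 : ℂ) else 0) (n j) * ξ n :=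
    fun ξ n => rfl
  have hU : ∀ s : Fin N, (s : ℕ) < d → Commute b (U σ s).1 := fun s hs =>
    commute_U_of_forall_apply σ (j := j) (s := s) (φ := fun x => if x = 0 then 1 else 0)
      (fun h => by rw [h] at hs; omega) hb
  have h := commute_of_mem_subtorus σ hU hg
  have h1 : b (lp.single 2 0 1) = lp.single 2 0 1 := by
    ext n
    rw [hb, lp.single_apply, Pi.single_apply]
    split_ifs with h0 <;> simp [h0]
  have h2 := DFunLike.congr_fun h.eq (lp.single 2 0 1)
  rw [mul_apply_eq_comp, mul_apply_eq_comp, h1] at h2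
  have h3 := congrArg (fun ξ : L2 (Zk k) ℂ => ξ m) h2
  simp only [hb, rep_single_zero_apply] at h3
  by_contra h0
  rw [if_neg h0, zero_mul] at h3
  exact hm h3.symm

theorem partialFin_apply (j : Fin N) (g : Zk k →₀ ℂ) (m : Zk k) :
    partialFin j g m = Complex.I * infCoord m j * g m := rfl

theorem partialFin_eq_zero_of_rep_mem_subtorus {d : ℕ} {g : Zk k →₀ ℂ}
    (hg : (rep σ g).1 ∈ subtorus d σ) {j : Fin N} (hj : d ≤ (j : ℕ)) : partialFin j g = 0 := by
  ext m
  rw [partialFin_apply, Finsupp.zero_apply]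
  by_cases hm : g m = 0
  · rw [hm, mul_zero]
  · simp [infCoord, intCoord, coord_eq_zero_of_rep_mem_subtorus σ hg hj hm]

theorem rep_mem_span (g : Zk k →₀ ℂ) : (rep σ g).1 ∈ Submodule.span ℂ (Set.range (W σ)) := by
  rw [coe_rep]
  exact sum_mem fun m _ => Submodule.smul_mem _ _ (Submodule.subset_span ⟨m, rfl⟩)

variable {C : Type*} [NormedAddCommGroup C] [InnerProductSpace ℂ C] [FiniteDimensional ℂ C]

theorem tensorOp_W_apply (m : Zk k) (t : C →L[ℂ] C) (ξ : L2 (Zk k) C) (n : Zk k) :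
    tensorOp (W σ m) t ξ n = (σ m (n - m) : ℂ) • t (ξ (n - m)) :=
  tensorOp_apply_of_forall (u := fun n => (σ m (n - m) : ℂ)) (e := fun n => n - m)
    (fun ξ n => W_apply σ m ξ n) t ξ n

variable {σ} {t : C →L[ℂ] C} {P : Set (Zk k)} {a : L2 (Zk k) ℂ →L[ℂ] L2 (Zk k) ℂ}

theorem preservesSobolev_tensorOp (ha : a ∈ Submodule.span ℂ (W σ '' P)) :
    PreservesSobolev (tensorOp a t) := by
  induction ha using Submodule.span_induction with
  | mem x hx =>
    obtain ⟨m, _, rfl⟩ := hx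
    exact preservesSobolev_of_forall_apply (fun _ => Circle.norm_coe _) (tensorOp_W_apply σ m t)
  | zero => rw [tensorOp_zero_left]; exact .zero
  | add x y _ _ hx hy => rw [tensorOp_add_left]; exact hx.add hy
  | smul z x _ hx => rw [tensorOp_smul_left]; exact hx.smul z

theorem isRegular_tensorOp (ha : a ∈ Submodule.span ℂ (W σ '' P)) :
    IsRegular (tensorOp a t) := by
  induction ha using Submodule.span_induction with
  | mem x hx =>
    obtain ⟨m, _, rfl⟩ := hx
    exact isRegular_of_forall_apply (fun _ => Circle.norm_coe _) (tensorOp_W_apply σ m t)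
  | zero => rw [tensorOp_zero_left]; exact .zero
  | add x y _ _ hx hy => rw [tensorOp_add_left]; exact hx.add hy
  | smul z x _ hx => rw [tensorOp_smul_left]; exact hx.smul z

theorem exists_hasCommutator_tensorOp (ha : a ∈ Submodule.span ℂ (W σ '' P)) (j : Fin N) :
    ∃ b, HasCommutator j (tensorOp a t) b := by
  induction ha using Submodule.span_induction with
  | mem x hx =>
    obtain ⟨m, _, rfl⟩ := hx
    exact ⟨_, hasCommutator_of_forall_apply (tensorOp_W_apply σ m t) j⟩
  | zero => rw [tensorOp_zero_left]; exact ⟨_, .zero⟩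
  | add x y hx' hy' hx hy =>
    rw [tensorOp_add_left]
    exact ⟨_, hx.choose_spec.add hy.choose_spec (preservesSobolev_tensorOp hx')
      (preservesSobolev_tensorOp hy')⟩
  | smul z x hx' hx =>
    rw [tensorOp_smul_left]
    exact ⟨_, hx.choose_spec.smul z (preservesSobolev_tensorOp hx')⟩

theorem hasCommutator_zero_tensorOp {j : Fin N}
    (ha : a ∈ Submodule.span ℂ (W σ '' {m | infCoord m j = 0})) :
    HasCommutator j (tensorOp a t) 0 := by
  induction ha using Submodule.span_induction with
  | mem x hx =>
    obtain ⟨m, hm, rfl⟩ := hx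
    have h := hasCommutator_of_forall_apply (tensorOp_W_apply σ m t) j
    rwa [hm.out, Int.cast_zero, mul_zero, zero_smul] at h
  | zero => rw [tensorOp_zero_left]; exact .zero
  | add x y hx' hy' hx hy =>
    rw [tensorOp_add_left]
    simpa using hx.add hy (preservesSobolev_tensorOp hx') (preservesSobolev_tensorOp hy')
  | smul z x hx' hx =>
    rw [tensorOp_smul_left]
    simpa using hx.smul z (preservesSobolev_tensorOp hx')

theorem hasCommutator_rep (j : Fin N) (g : Zk k →₀ ℂ) :
    HasCommutator j (tensorOp (rep σ g).1 t) (tensorOp (rep σ (partialFin j g)).1 t) := by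
  have h : (rep σ (partialFin j g)).1 =
      ∑ m ∈ g.support, (Complex.I * infCoord m j * g m) • W σ m := by
    rw [coe_rep]
    exact Finsupp.sum_of_support_subset _ Finsupp.support_onFinset_subset _ (by simp)
  -- The two claims are proved together because commutators are added only for operators preserving
  -- the Sobolev space.
  have hz : ∀ s : Finset (Zk k), PreservesSobolev (tensorOp (∑ m ∈ s, g m • W σ m) t) ∧
      HasCommutator j (tensorOp (∑ m ∈ s, g m • W σ m) t)
        (tensorOp (∑ m ∈ s, (Complex.I * infCoord m j * g m) • W σ m) t) := by
    classical
    intro s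
    induction s using Finset.induction_on with
    | empty =>
      rw [Finset.sum_empty, Finset.sum_empty, tensorOp_zero_left]
      exact ⟨.zero, .zero⟩
    | insert m s hm ih =>
      rw [Finset.sum_insert hm, Finset.sum_insert hm, tensorOp_add_left, tensorOp_add_left,
        tensorOp_smul_left, mul_comm, mul_smul, tensorOp_smul_left, tensorOp_smul_left]
      have hp : PreservesSobolev (tensorOp (W σ m) t) :=
        preservesSobolev_of_forall_apply (fun _ => Circle.norm_coe _) (tensorOp_W_apply σ m t)
      have hc := hasCommutator_of_forall_apply (tensorOp_W_apply σ m t) j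
      exact ⟨(hp.smul _).add ih.1, (hc.smul (g m) hp).add ih.2 (hp.smul _) ih.1⟩
  rw [h, coe_rep]
  exact (hz g.support).2

end Coefficients

/-! ### The decomposition of the Dirac operator -/

section Decomposition

variable {N d : ℕ} {k : Fin N → ℕ∞} (σ : NormalizedCocycle (Zk k)) (f : Equiv.Perm (Fin N))
  (hd : d ≤ N)

/-- The index in `{1, …, N}` of the coordinate which is differentiated by `Γ_i`. -/
def baseIndex : Fin (d + N) → Fin N := Fin.addCases (Fin.castLE hd) id

@[simp]
theorem baseIndex_castAdd (j : Fin d) : baseIndex hd (Fin.castAdd N j) = Fin.castLE hd j := by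
  simp [baseIndex]

@[simp]
theorem baseIndex_natAdd (j : Fin N) : baseIndex hd (Fin.natAdd d j) = j := by
  simp [baseIndex]

/-- The coefficient of the derivative in `Γ_i`. -/
def firstCoeff (i : Fin (d + N)) : L2 (Zk k) ℂ →L[ℂ] L2 (Zk k) ℂ :=
  if k (baseIndex hd i) = ⊤ then
    Fin.addCases (motive := fun _ => L2 (Zk k) ℂ →L[ℂ] L2 (Zk k) ℂ)
      (fun j => (X σ f (Fin.castLE hd j)).1) (fun j => if (j : ℕ) < d then (Y σ f j).1 else 1) i
  else 0

/-- The bounded part of `Γ_i`. -/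
def zerothCoeff (i : Fin (d + N)) : L2 (Zk k) ℂ →L[ℂ] L2 (Zk k) ℂ :=
  if k (baseIndex hd i) = ⊤ then 0 else
    (((k (baseIndex hd i)).toNat : ℂ) / (2 * Complex.I * Real.pi)) •
      Fin.addCases (motive := fun _ => L2 (Zk k) ℂ →L[ℂ] L2 (Zk k) ℂ)
        (fun j => -adOp (Y σ f (Fin.castLE hd j)).1) (fun j => if (j : ℕ) < d then
          adOp (X σ f j).1 else 1 - imPart (dualUnitary k (zElt k j))) i

/-- In each direction one of the two terms vanishes: the bounded one if `k j = ∞`, the first order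
one otherwise. -/
theorem Gamma_apply (i : Fin (d + N)) (ζ : sobolev k ℂ) :
    Gamma σ f hd i ζ =
      zerothCoeff σ f hd i ζ + firstCoeff σ f hd i (partialOp (baseIndex hd i) ζ) := by
  induction i using Fin.addCases with
  | left j =>
    by_cases h : k (Fin.castLE hd j) = ⊤
    · simp [Gamma, Gamma₁, zerothCoeff, firstCoeff, h]
    · simp [Gamma, Gamma₁, zerothCoeff, firstCoeff, h, neg_div]
  | right j =>
    by_cases h : k j = ⊤ <;> by_cases hj : (j : ℕ) < d <;>
    simp [Gamma, Gamma₂, zerothCoeff, firstCoeff, h, hj]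

variable {C : Type*} [NormedAddCommGroup C] [InnerProductSpace ℂ C]

theorem partialOp_sobolevSlice (j : Fin N) (v : C) (ξ : sobolev k C) :
    partialOp j (sobolevSlice v ξ) = slice (Zk k) v (deriv j ξ) := by
  ext m
  exact (inner_smul_right (𝕜 := ℂ) v (ξ.1 m) _).symm

variable [FiniteDimensional ℂ C]

theorem tensorUnbounded_apply {Γ : sobolev k ℂ →ₗ[ℂ] L2 (Zk k) ℂ}
    {a b : L2 (Zk k) ℂ →L[ℂ] L2 (Zk k) ℂ} {j : Fin N}
    (h : ∀ ζ : sobolev k ℂ, Γ ζ = b ζ + a (partialOp j ζ)) (t : C →L[ℂ] C) (ξ : sobolev k C) :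
    tensorUnbounded Γ t ξ = tensorOp b t ξ + tensorOp a t (deriv j ξ) := by
  rw [tensorOp_eq, tensorOp_eq, ← Finset.sum_add_distrib, tensorUnbounded, LinearMap.sum_apply]
  refine Finset.sum_congr rfl fun i _ => ?_
  rw [← partialOp_sobolevSlice, ← map_add]
  exact congrArg (tmulRight (Zk k) _) (h _)

variable (c : CliffordRep (d + N) C)

/-- The symbol of the Dirac operator. -/
def symbol (i : Fin (d + N)) : L2 (Zk k) C →L[ℂ] L2 (Zk k) C :=
  tensorOp (firstCoeff σ f hd i) (c.toAlgHom (gam i))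

/-- The bounded part of the Dirac operator. -/
def boundedPart : L2 (Zk k) C →L[ℂ] L2 (Zk k) C :=
  ∑ i, tensorOp (zerothCoeff σ f hd i) (c.toAlgHom (gam i))

theorem dirac_apply (ξ : (dirac σ f hd c).domain) (η : sobolev k C)
    (h : (ξ : L2 (Zk k) C) = η) :
    dirac σ f hd c ξ = boundedPart σ f hd c η +
      principal (baseIndex hd) (symbol σ f hd c) η := by
  have hξ : dirac σ f hd c ξ =
      (∑ j, tensorUnbounded (Gamma σ f hd j) (c.toAlgHom (gam j)) : sobolev k C →ₗ[ℂ] _) η :=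
    congrArg (dirac σ f hd c).toFun (Subtype.ext h)
  rw [hξ, LinearMap.sum_apply, principal_apply, boundedPart, sum_apply, ← Finset.sum_add_distrib]
  exact Finset.sum_congr rfl fun i _ => tensorUnbounded_apply (Gamma_apply σ f hd i) _ η

theorem star_adOp (a : L2 (Zk k) ℂ →L[ℂ] L2 (Zk k) ℂ) : star (adOp a) = adOp (star a) := by
  rw [adOp, adOp, star_sub, star_rightAct]

/-- The factor `k / (2 i π)` is purely imaginary and multiplies a self-adjoint operator. Tensoring
with the skew `γ_i` then makes `boundedPart` self-adjoint. -/
theorem star_zerothCoeff (i : Fin (d + N)) :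
    star (zerothCoeff σ f hd i) = -zerothCoeff σ f hd i := by
  have hz : ∀ n : ℕ, star ((n : ℂ) / (2 * Complex.I * Real.pi)) =
      -((n : ℂ) / (2 * Complex.I * Real.pi)) := fun n => by
    simp [div_neg]
  unfold zerothCoeff
  split_ifs with h
  · simp
  · rw [star_smul, hz, neg_smul]
    congr 2
    induction i using Fin.addCases with
    | left j => simp [star_adOp, star_Y]
    | right j =>
      by_cases hj : (j : ℕ) < d <;> simp [hj, star_adOp, star_X, star_imPart]

theorem star_firstCoeff (i : Fin (d + N)) : star (firstCoeff σ f hd i) = firstCoeff σ f hd i := by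
  unfold firstCoeff
  split_ifs with h
  · induction i using Fin.addCases with
    | left j => simp [star_X]
    | right j => by_cases hj : (j : ℕ) < d <;> simp [hj, star_Y]
  · simp

theorem isSelfAdjoint_boundedPart : IsSelfAdjoint (boundedPart σ f hd c) := by
  rw [IsSelfAdjoint, boundedPart, star_sum]
  refine Finset.sum_congr rfl fun i _ => ?_
  rw [star_tensorOp, star_zerothCoeff, c.star_gam, tensorOp_neg_left, tensorOp_neg_right, neg_neg]

variable {f} (hf : ∀ j, f j ≠ j)

-- Because `f j ≠ j`, translations by `± e_{f j}` leave the `j`-th coordinate unchanged.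
include hf in
theorem firstCoeff_mem_span (i : Fin (d + N)) :
    firstCoeff σ f hd i ∈ Submodule.span ℂ (W σ '' {m | infCoord m (baseIndex hd i) = 0}) := by
  have h1 : ∀ j : Fin N, Pi.single (f j) 1 ∈ {m : Zk k | infCoord m j = 0} := fun j =>
    infCoord_single_ne (hf j) _
  have h2 : ∀ j : Fin N, -Pi.single (f j) 1 ∈ {m : Zk k | infCoord m j = 0} := fun j => by
    rw [Set.mem_ofPred_eq, infCoord_neg, infCoord_single_ne (hf j), neg_zero]
  unfold firstCoeff
  split_ifs with h
  · induction i using Fin.addCases with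
    | left j =>
      rw [Fin.addCases_left, baseIndex_castAdd]
      exact X_mem_span σ f (h1 _) (h2 _)
    | right j =>
      rw [Fin.addCases_right, baseIndex_natAdd]
      split_ifs with hj
      · exact Y_mem_span σ f (h1 _) (h2 _)
      -- The constant coefficient `1` is the translation by zero.
      · exact Submodule.subset_span ⟨0, infCoord_zero j, W_zero σ⟩
  · exact zero_mem _

variable (hU : ∀ j : Fin N, (j : ℕ) < d → k j = ⊤ → ∀ s, U σ (f j) * U σ s = U σ s * U σ (f j))

include hU

theorem commute_firstCoeff_U (i : Fin (d + N)) (s : Fin N) :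
    Commute (firstCoeff σ f hd i) (U σ s).1 := by
  have hU' : ∀ j : Fin N, (j : ℕ) < d → k j = ⊤ → Commute (U σ s).1 (U σ (f j)).1 :=
    fun j hj hk => (congrArg Subtype.val (hU j hj hk s)).symm
  unfold firstCoeff
  split_ifs with h
  · induction i using Fin.addCases with
    | left j =>
      rw [baseIndex_castAdd] at h
      rw [Fin.addCases_left]
      exact (commute_X σ f (hU' _ j.2 h)).symm
    | right j =>
      rw [baseIndex_natAdd] at h
      rw [Fin.addCases_right]
      split_ifs with hj
      · exact (commute_Y σ f (hU' _ hj h)).symm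
      · exact Commute.one_left _
  · exact Commute.zero_left _

theorem commute_firstCoeff (i l : Fin (d + N)) :
    Commute (firstCoeff σ f hd i) (firstCoeff σ f hd l) := by
  conv_rhs => rw [firstCoeff]
  split_ifs with h
  · induction l using Fin.addCases with
    | left j =>
      rw [Fin.addCases_left]
      exact commute_X σ f (commute_firstCoeff_U σ hd hU i _)
    | right j =>
      rw [Fin.addCases_right]
      split_ifs with hj
      · exact commute_Y σ f (commute_firstCoeff_U σ hd hU i _)
      · exact Commute.one_right _
  · exact Commute.zero_right _

omit hU

theorem sum_castLE_eq {M : Type*} [AddCommMonoid M] (F : Fin N → M) :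
    ∑ j : Fin d, F (Fin.castLE hd j) = ∑ j : Fin N, if (j : ℕ) < d then F j else 0 := by
  rw [← Finset.sum_filter]
  refine Finset.sum_nbij (Fin.castLE hd) (fun j _ => by simp) (fun _ _ _ _ h => by simpa using h)
    (fun j hj => ?_) fun _ _ => rfl
  exact ⟨⟨j, by simpa using hj⟩, by simp, rfl⟩

theorem toAlgHom_gam_mul_self (i : Fin (d + N)) : c.toAlgHom (gam i) * c.toAlgHom (gam i) = -1 := by
  have h := gam_mul_gam_add i i
  rw [if_pos rfl, ← two_smul ℂ] at h
  have h' := congrArg c.toAlgHom h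
  rw [map_smul, map_mul, map_neg, map_ofNat] at h'
  refine smul_right_injective _ (two_ne_zero (α := ℂ)) (h'.trans ?_)
  simp only [smul_neg, ofNat_smul_eq_nsmul]
  norm_num

/-- As `γ_i` is skew with square `-1`, it drops out of `T* T`. Norms with different Clifford
generators thus become quadratic forms that can be added. -/
theorem norm_sq_tensorOp_apply {a : L2 (Zk k) ℂ →L[ℂ] L2 (Zk k) ℂ} (ha : star a = a)
    (i : Fin (d + N)) (v : L2 (Zk k) C) :
    ‖tensorOp a (c.toAlgHom (gam i)) v‖ ^ 2 = (inner ℂ v (tensorOp (a * a) 1 v)).re := by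
  have h : star (tensorOp a (c.toAlgHom (gam i))) * tensorOp a (c.toAlgHom (gam i)) =
      tensorOp (a * a) 1 := by
    rw [star_tensorOp, tensorOp_mul, ha, c.star_gam, neg_mul, toAlgHom_gam_mul_self, neg_neg]
  rw [← h, mul_apply_eq_comp, ContinuousLinearMap.star_eq_adjoint,
    ContinuousLinearMap.adjoint_inner_right, ← @inner_self_eq_norm_sq ℂ]
  rfl

theorem tensorOp_one_one : tensorOp (1 : L2 (Zk k) ℂ →L[ℂ] L2 (Zk k) ℂ) (1 : C →L[ℂ] C) = 1 :=
  (ampliation (Zk k) C).map_one'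

include hf hU in
theorem isDiracSymbol_symbol : IsDiracSymbol (baseIndex hd) (symbol σ f hd c) where
  preserves i := preservesSobolev_tensorOp (firstCoeff_mem_span σ hd hf i)
  exists_commutator i j := exists_hasCommutator_tensorOp (firstCoeff_mem_span σ hd hf i) j
  commute i := hasCommutator_zero_tensorOp (firstCoeff_mem_span σ hd hf i)
  regular i := isRegular_tensorOp (firstCoeff_mem_span σ hd hf i)
  skew i := by
    rw [symbol, star_tensorOp, star_firstCoeff, c.star_gam, tensorOp_neg_right]
  anticomm i l hil := by
    have h := gam_mul_gam_add i l
    rw [if_neg hil] at h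
    have h' : c.toAlgHom (gam i) * c.toAlgHom (gam l) =
        -(c.toAlgHom (gam l) * c.toAlgHom (gam i)) := by
      rw [eq_neg_iff_add_eq_zero, ← map_mul, ← map_mul, ← map_add, h, map_zero]
    rw [symbol, symbol, tensorOp_mul, tensorOp_mul, (commute_firstCoeff σ hd hU i l).eq, h',
      tensorOp_neg_right]
  sum_norm_sq ξ := by
    rw [Fin.sum_univ_add]
    simp only [baseIndex_castAdd, baseIndex_natAdd]
    -- The indices `j` and `d + j` differentiate the same coordinate. Extending the first sum by
    -- zero to all of `Fin N` pairs them, so that `X_j² + Y_j² = 1` applies.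
    have h1 : ∑ j : Fin d, ‖symbol σ f hd c (Fin.castAdd N j) (deriv (Fin.castLE hd j) ξ)‖ ^ 2 =
        ∑ j : Fin N, if (j : ℕ) < d then (if k j = ⊤ then
          (inner ℂ (deriv j ξ) (tensorOp ((X σ f j).1 * (X σ f j).1) 1 (deriv j ξ))).re
            else 0) else 0 := by
      rw [← sum_castLE_eq hd fun j => if k j = ⊤ then
          (inner ℂ (deriv j ξ) (tensorOp ((X σ f j).1 * (X σ f j).1) 1 (deriv j ξ))).re else 0]
      refine Finset.sum_congr rfl fun j _ => ?_
      split_ifs with h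
      · rw [← norm_sq_tensorOp_apply c (star_X σ f _) (Fin.castAdd N j)]
        simp [symbol, firstCoeff, h]
      · simp [deriv_eq_zero h]
    rw [h1, ← Finset.sum_add_distrib]
    refine Finset.sum_congr rfl fun j _ => ?_
    by_cases h : k j = ⊤
    · by_cases hj : (j : ℕ) < d
      · have h2 : firstCoeff σ f hd (Fin.natAdd d j) = (Y σ f j).1 := by simp [firstCoeff, h, hj]
        rw [if_pos hj, if_pos h, symbol, h2, norm_sq_tensorOp_apply c (star_Y σ f j),
          ← Complex.add_re, ← inner_add_right, ← add_apply, ← tensorOp_add_left,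
          X_mul_self_add_Y_mul_self, tensorOp_one_one, ← @inner_self_eq_norm_sq ℂ]
        rfl
      · have h2 : firstCoeff σ f hd (Fin.natAdd d j) = 1 := by simp [firstCoeff, h, hj]
        rw [if_neg hj, symbol, h2, norm_sq_tensorOp_apply c (star_one _), mul_one, tensorOp_one_one,
          zero_add, ← @inner_self_eq_norm_sq ℂ]
        rfl
    · simp [deriv_eq_zero h, h]

end Decomposition

/-! ### Commutators with the Dirac operator -/

section Commutators

variable {N d : ℕ} {k : Fin N → ℕ∞} (σ : NormalizedCocycle (Zk k)) (f : Equiv.Perm (Fin N))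
  (hd : d ≤ N)

/-- The coefficient of `gam i` in the commutator of the Dirac operator with `π(g)`. -/
def gradCoeff (g : Zk k →₀ ℂ) (i : Fin (d + N)) : L2 (Zk k) ℂ →L[ℂ] L2 (Zk k) ℂ :=
  (zerothCoeff σ f hd i * (rep σ g).1 - (rep σ g).1 * zerothCoeff σ f hd i) +
    firstCoeff σ f hd i * (rep σ (partialFin (baseIndex hd i) g)).1

/-- The right multiplication in `adOp a` commutes with `b` and cancels, so only the left commutator
remains. -/
theorem adOp_mul_sub_mul_adOp {a b : L2 (Zk k) ℂ →L[ℂ] L2 (Zk k) ℂ} (h : Commute (rightAct a) b) :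
    adOp a * b - b * adOp a = a * b - b * a := by
  rw [adOp, sub_mul, mul_sub, h.eq, sub_sub_sub_cancel_right]

theorem X_mem_span_range (j : Fin N) : (X σ f j).1 ∈ Submodule.span ℂ (Set.range (W σ)) := by
  rw [← Set.image_univ]
  exact X_mem_span σ f trivial trivial

theorem Y_mem_span_range (j : Fin N) : (Y σ f j).1 ∈ Submodule.span ℂ (Set.range (W σ)) := by
  rw [← Set.image_univ]
  exact Y_mem_span σ f trivial trivial

theorem adOp_X_mul_sub (j : Fin N) (g : Zk k →₀ ℂ) :
    adOp (X σ f j).1 * (rep σ g).1 - (rep σ g).1 * adOp (X σ f j).1 =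
      ⁅X σ f j, rep σ g⁆.1 :=
  adOp_mul_sub_mul_adOp (commute_rightAct_of_mem_span σ (X_mem_span_range σ f j) (rep_mem_span σ g))

theorem adOp_Y_mul_sub (j : Fin N) (g : Zk k →₀ ℂ) :
    adOp (Y σ f j).1 * (rep σ g).1 - (rep σ g).1 * adOp (Y σ f j).1 =
      ⁅Y σ f j, rep σ g⁆.1 :=
  adOp_mul_sub_mul_adOp (commute_rightAct_of_mem_span σ (Y_mem_span_range σ f j) (rep_mem_span σ g))

theorem rep_zero : rep σ 0 = 0 := Finsupp.sum_zero_index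

variable {C : Type*} [NormedAddCommGroup C] [InnerProductSpace ℂ C] [FiniteDimensional ℂ C]
  (c : CliffordRep (d + N) C)

theorem idTensor_tmul {M : ℕ} (c : CliffordRep M C) (a : torus σ) (x : Cl M) :
    idTensor σ c (a ⊗ₜ[ℂ] x) = tensorOp a.1 (c.toAlgHom x) := rfl

theorem idTensor_grad {g : Zk k →₀ ℂ} (hg : (rep σ g).1 ∈ subtorus d σ) :
    idTensor σ c (grad σ f hd g) = ∑ i, tensorOp (gradCoeff σ f hd g i) (c.toAlgHom (gam i)) := by
  -- Beyond `d` the element has no `j`-th coordinate: its derivative is zero, and it commutes with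
  -- functions of that coordinate. These are the indices absent from the gradient.
  have hvanish : ∀ j : Fin N, ¬ (j : ℕ) < d → gradCoeff σ f hd g (Fin.natAdd d j) = 0 := by
    intro j hj
    have h1 : partialFin j g = 0 := partialFin_eq_zero_of_rep_mem_subtorus σ hg (not_lt.1 hj)
    rw [gradCoeff, baseIndex_natAdd, h1, rep_zero, ZeroMemClass.coe_zero, mul_zero, add_zero]
    by_cases h : k j = ⊤
    · simp [zerothCoeff, h]
    · have h2 : Commute (imPart (dualUnitary k (zElt k j))) (rep σ g).1 :=
        commute_of_mem_subtorus σ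
          (fun s hs => commute_imPart_dualUnitary σ h (fun hsj => hj (hsj ▸ hs))) hg
      have h3 : Commute (zerothCoeff σ f hd (Fin.natAdd d j)) (rep σ g).1 := by
        simp only [zerothCoeff, baseIndex_natAdd, h, if_false, Fin.addCases_right, hj]
        exact ((Commute.one_left _).sub_left h2).smul_left _
      rw [h3.eq, sub_self]
  have hsum : ∑ j : Fin N, tensorOp (gradCoeff σ f hd g (Fin.natAdd d j))
      (c.toAlgHom (gam (Fin.natAdd d j))) =
      ∑ j : Fin d, tensorOp (gradCoeff σ f hd g (Fin.natAdd d (Fin.castLE hd j)))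
        (c.toAlgHom (gam (Fin.natAdd d (Fin.castLE hd j)))) := by
    rw [sum_castLE_eq hd fun j => tensorOp (gradCoeff σ f hd g (Fin.natAdd d j))
      (c.toAlgHom (gam (Fin.natAdd d j)))]
    refine Finset.sum_congr rfl fun j _ => ?_
    split_ifs with hj
    · rfl
    · rw [hvanish j hj, tensorOp_zero_left]
  rw [Fin.sum_univ_add, hsum, ← Finset.sum_add_distrib, grad, map_add, map_sum, map_sum,
    Finset.sum_filter, Finset.sum_filter, ← Finset.sum_add_distrib]
  refine Finset.sum_congr rfl fun j _ => ?_
  by_cases h : k (Fin.castLE hd j) = ⊤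
  · simp [h, idTensor_tmul, gradCoeff, zerothCoeff, firstCoeff]
  · have h1 : gradCoeff σ f hd g (Fin.castAdd N j) =
        (((k (Fin.castLE hd j)).toNat : ℂ) / (2 * Complex.I * Real.pi)) •
          -⁅Y σ f (Fin.castLE hd j), rep σ g⁆.1 := by
      simp only [gradCoeff, zerothCoeff, firstCoeff, baseIndex_castAdd, h, if_false,
        Fin.addCases_left, zero_mul, add_zero]
      rw [smul_mul_assoc, mul_smul_comm, ← smul_sub, neg_mul, mul_neg, neg_sub_neg, ← neg_sub,
        adOp_Y_mul_sub]
    have h2 : gradCoeff σ f hd g (Fin.natAdd d (Fin.castLE hd j)) =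
        (((k (Fin.castLE hd j)).toNat : ℂ) / (2 * Complex.I * Real.pi)) •
          ⁅X σ f (Fin.castLE hd j), rep σ g⁆.1 := by
      simp only [gradCoeff, zerothCoeff, firstCoeff, baseIndex_natAdd, h, if_false,
        Fin.addCases_right, zero_mul, add_zero, Fin.val_castLE, j.2, if_true]
      rw [smul_mul_assoc, mul_smul_comm, ← smul_sub, adOp_X_mul_sub]
    rw [if_neg h, if_pos h, zero_add, h1, h2, map_smul, map_sub, idTensor_tmul, idTensor_tmul,
      tensorOp_smul_left, tensorOp_smul_left, tensorOp_neg_left, ← smul_add, neg_add_eq_sub]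

theorem ampliation_rep_mem_sobolev (g : Zk k →₀ ℂ) {ξ : L2 (Zk k) C} (hξ : ξ ∈ sobolev k C) :
    ampliation (Zk k) C (rep σ g) ξ ∈ sobolev k C := by
  have h := rep_mem_span σ g
  rw [← Set.image_univ] at h
  exact preservesSobolev_tensorOp h ξ hξ

theorem dirac_commutator
    (hU : ∀ j : Fin N, (j : ℕ) < d → k j = ⊤ → ∀ s, U σ (f j) * U σ s = U σ s * U σ (f j))
    {g : Zk k →₀ ℂ} (hg : (rep σ g).1 ∈ subtorus d σ) (ξ η : (dirac σ f hd c).domain)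
    (h : (η : L2 (Zk k) C) = ampliation (Zk k) C (rep σ g) ξ) :
    dirac σ f hd c η - ampliation (Zk k) C (rep σ g) (dirac σ f hd c ξ) =
      idTensor σ c (grad σ f hd g) ξ := by
  set a : L2 (Zk k) C →L[ℂ] L2 (Zk k) C := tensorOp (rep σ g).1 1 with ha
  change (η : L2 (Zk k) C) = a ξ at h
  change dirac σ f hd c η - a (dirac σ f hd c ξ) = _
  obtain ⟨ξ', hξ⟩ : ∃ ξ' : sobolev k C, (ξ : L2 (Zk k) C) = ξ' := ⟨ξ, rfl⟩
  obtain ⟨η', hη⟩ : ∃ η' : sobolev k C, (η : L2 (Zk k) C) = η' := ⟨η, rfl⟩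
  rw [hξ, hη] at h
  rw [dirac_apply σ f hd c ξ ξ' hξ, dirac_apply σ f hd c η η' hη, hξ, idTensor_grad σ f hd c hg,
    principal_apply, principal_apply, map_add, map_sum, add_sub_add_comm, ← Finset.sum_sub_distrib,
    h, boundedPart, sum_apply, sum_apply, sum_apply, map_sum, ← Finset.sum_sub_distrib,
    ← Finset.sum_add_distrib]
  refine Finset.sum_congr rfl fun i _ => ?_
  have h1 := hasCommutator_rep (t := 1) (baseIndex hd i) g ξ' η' h
  -- The coefficient commutes with the subtorus, so the first order terms cancel and the Leibniz
  -- rule leaves only the derivative of `a`.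
  have h2 : symbol σ f hd c i * a = a * symbol σ f hd c i := by
    rw [ha, symbol, tensorOp_mul, tensorOp_mul, mul_one, one_mul,
      (commute_of_mem_subtorus σ (fun s _ => commute_firstCoeff_U σ hd hU i s) hg).eq]
  have h3 := DFunLike.congr_fun h2 (deriv (baseIndex hd i) ξ')
  rw [mul_apply_eq_comp, mul_apply_eq_comp] at h3
  rw [h1, map_add, h3, add_sub_cancel_left, gradCoeff, tensorOp_add_left, add_apply,
    tensorOp_sub_left, sub_apply]
  congr 1
  · rw [← mul_apply_eq_comp, ← mul_apply_eq_comp, ha, tensorOp_mul, tensorOp_mul, mul_one, one_mul]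
  · rw [symbol, ← mul_apply_eq_comp, tensorOp_mul, mul_one]

/-- The finitely supported elements of the subtorus form a dense *-subalgebra. -/
theorem exists_dense_starSubalgebra : ∃ S : StarSubalgebra ℂ (subtorus d σ),
    Dense (S : Set (subtorus d σ)) ∧ ∀ a ∈ S, ∃ g, a.1 = (rep σ g).1 := by
  set gens : Set (L2 (Zk k) ℂ →L[ℂ] L2 (Zk k) ℂ) :=
    {T | ∃ j : Fin N, (j : ℕ) < d ∧ T = (U σ j).1} with hgens
  refine ⟨(StarAlgebra.adjoin ℂ gens).comap (subtorus d σ).subtype, ?_, ?_⟩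
  · rw [Subtype.dense_iff]
    intro a ha
    refine closure_mono ?_ ha
    intro b hb
    exact ⟨⟨b, StarSubalgebra.le_topologicalClosure _ hb⟩, hb, rfl⟩
  · intro a ha
    refine exists_eq_rep σ (mem_span_W_of_mem_adjoin σ ?_ ha)
    rintro _ ⟨j, _, rfl⟩
    exact ⟨_, rfl⟩

end Commutators

/-! ### Assembly of the spectral triple -/

theorem isSpectralTriple_dirac {N d : ℕ} {k : Fin N → ℕ∞} (hk : ∀ j, k j ≠ 0)
    (σ : NormalizedCocycle (Zk k)) {f : Equiv.Perm (Fin N)} (hf : ∀ j, f j ≠ j) (hd : d ≤ N)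
    (hU : ∀ j : Fin N, (j : ℕ) < d → k j = ⊤ → ∀ s, U σ (f j) * U σ s = U σ s * U σ (f j))
    {C : Type*} [NormedAddCommGroup C] [InnerProductSpace ℂ C] [FiniteDimensional ℂ C]
    (c : CliffordRep (d + N) C) :
    IsSpectralTriple ((ampliation (Zk k) C).comp (subtorus d σ).subtype) (dirac σ f hd c) := by
  have hsymbol := isDiracSymbol_symbol σ hd c hf hU
  have hsa : IsSelfAdjoint (dirac σ f hd c) :=
    hsymbol.isSelfAdjoint (isSelfAdjoint_boundedPart σ f hd c) rfl (dirac_apply σ f hd c)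
  refine ⟨dense_sobolev, hsa, ?_, ?_⟩
  · obtain ⟨L, _, hL⟩ := hsymbol.exists_sum_norm_sq_le_add (boundedPart σ f hd c)
    refine hasCompactResolvent_of_bound hk hsa rfl (L := L) fun ξ η h => ?_
    rw [dirac_apply σ f hd c ξ η h, h]
    exact hL η
  · obtain ⟨S, hS, hrep⟩ := exists_dense_starSubalgebra (d := d) σ
    refine ⟨S, hS, fun a ha => ?_⟩
    obtain ⟨g, hg⟩ := hrep a ha
    have hg' : (rep σ g).1 ∈ subtorus d σ := hg ▸ a.2
    obtain rfl : a = ⟨(rep σ g).1, hg'⟩ := Subtype.ext hg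
    exact ⟨fun ξ hξ => ampliation_rep_mem_sobolev σ g hξ, ‖idTensor σ c (grad σ f hd g)‖,
      fun ξ η h => by
        have h1 := dirac_commutator σ f hd c hU hg' ξ η h
        exact (congrArg norm h1).trans_le (ContinuousLinearMap.le_opNorm _ _)⟩

end FuzzyTori

end

open FuzzyTori in
theorem mainTheorem4 {d d' : ℕ} (hd2 : 2 ≤ d) (hd : d ≤ d')
    (k : ℕ∞ → Fin d → ℕ∞) (σ : ∀ n, NormalizedCocycle (Zk (k n)))
    (h : IsApproximation k σ)
    (k' : ℕ∞ → Fin d' → ℕ∞) (σ' : ∀ n, NormalizedCocycle (Zk (k' n)))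
    (f : Equiv.Perm (Fin d')) (h' : IsInnerification hd k σ k' σ' f)
    {C : Type*} [NormedAddCommGroup C] [InnerProductSpace ℂ C] [FiniteDimensional ℂ C]
    (c : CliffordRep (d + d') C) (n : ℕ∞) :
    IsSpectralTriple ((ampliation (Zk (k' n)) C).comp (subtorus d (σ' n)).subtype)
        (dirac (σ' n) f hd c) ∧
      ∀ g : Zk (k' n) →₀ ℂ, (rep (σ' n) g : L2 (Zk (k' n)) ℂ →L[ℂ] L2 (Zk (k' n)) ℂ) ∈
          subtorus d (σ' n) →
        ∀ ξ : (dirac (σ' n) f hd c).domain,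
          ∃ hξ : ampliation (Zk (k' n)) C (rep (σ' n) g) ξ ∈ (dirac (σ' n) f hd c).domain,
            dirac (σ' n) f hd c ⟨ampliation (Zk (k' n)) C (rep (σ' n) g) ξ, hξ⟩ -
                ampliation (Zk (k' n)) C (rep (σ' n) g) (dirac (σ' n) f hd c ξ) =
              idTensor (σ' n) c (grad (σ' n) f hd g) ξ := by
  have hk : ∀ j, k' n j ≠ 0 := fun j h0 => by
    have := h'.approximation.two_le n j
    rw [h0] at this
    exact absurd this (by decide)
  -- When `k n j = ∞` both exceptional branches of the commutation relation are void, so `U_{f j}`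
  -- is central among the generators.
  have hU : ∀ j : Fin d', (j : ℕ) < d → k' n j = ⊤ → ∀ s,
      U (σ' n) (f j) * U (σ' n) s = U (σ' n) s * U (σ' n) (f j) := by
    intro j hj hkj s
    have hkn : k n ⟨j, hj⟩ = ⊤ := (h'.k'_eq n ⟨j, hj⟩).symm.trans hkj
    simpa [hkn] using h'.commutation n ⟨j, hj⟩ s
  exact ⟨isSpectralTriple_dirac hk (σ' n) h'.no_fixed_point hd hU c, fun g hg ξ =>
    ⟨ampliation_rep_mem_sobolev (σ' n) g ξ.2,
      dirac_commutator (σ' n) f hd c hU hg ξ _ rfl⟩⟩
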